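/- Let $Q$ be a Dynkin quiver, i.e. a finite quiver without oriented cycles whose Cartan matrix $C=(c_{ij})_{i,j\in\mathbb I}$, with $c_{ii}=2$ and $-c_{ij}$ the number of arrows connecting $i$ and $j$ (in either direction) for $i\ne j$, is positive definite (equivalently, each connected component of the underlying graph is a Dynkin diagram of type ADE). Let $\tau$ be an involution of $Q$, i.e. an automorphism of the quiver with $\tau^2=\mathrm{Id}$ ($\tau=\mathrm{Id}$ is allowed), and let $\mathbb I_\tau\subseteq\mathbb I$ be a set of representatives of the $\tau$-orbits of vertices. Let $s_i(\alpha_j)=\alpha_j-c_{ij}\alpha_i$ be the simple reflections of the root lattice $\mathbb Z^{\mathbb I}=\bigoplus_{i}\mathbb Z\alpha_i$, let $W=\langle s_i\mid i\in\mathbb I\rangle$ be the Weyl group, $\Phi$ the root system, $\Phi^+$ the set of positive roots, and let $w_0$ be the longest element of $W$. Let $\tau$ act on $\mathbb Z^{\mathbb I}$ by $\alpha_i\mapsto\alpha_{\tau i}$, let $W_\tau=\{w\in W\mid \tau w=w\tau\}$, and put $\mathbf s_i=s_i$ if $\tau i=i$ and $\mathbf s_i=s_is_{\tau i}$ if $\tau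 i\neq i$. For a sink $i$ of $Q$, let $\mathbf s_i(Q)$ be the quiver obtained from $Q$ by reversing all arrows ending at $i$ or at $\tau i$. A sequence $i_1,\dots,i_t$ in $\mathbb I_\tau$ is called $\imath$-admissible if $i_r$ is a sink of $\mathbf s_{i_{r-1}}\cdots\mathbf s_{i_1}(Q)$ for each $1\le r\le t$; in this case put $\beta_j=\mathbf s_{i_1}\cdots\mathbf s_{i_{j-1}}(\alpha_{i_j})$. For a field $k$ and $\beta\in\Phi^+$, let $M(\beta)$ be the indecomposable $kQ$-module with dimension vector $\beta$. An ordering $\gamma_1,\dots,\gamma_N$ of $\Phi^+$ (each positive root occurring exactly once) is called $Q$-admissible if, for every field $k$ and all $r,t$, $\mathrm{Hom}_{kQ}(M(\gamma_r),M(\gamma_t))\ne0$ implies $r\le t$, and $\mathrm{Ext}^1_{kQ}(M(\gamma_r),M(\gamma_t))\neq0$ implies $r>t$. Then there is an $\imath$-admissible sequence $i_1,\dots,i_{N_\imath}$ in $\mathbb I_\tau$ such that $$\beta_1,\tau(\beta_1),\beta_2,\tau(\beta_2),\dots,\beta_{N_\imath},\tau(\beta_{N_\imath}),$$ with $\tau(\beta_j)$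 omitted whenever $\tau(\beta_j)=\beta_j$, is a $Q$-admissible ordering of $\Phi^+$. Moreover, $w_0$ lies in $W_\tau$ and is also an element of maximal length in $W_\tau$ with respect to the generators $\mathbf s_i$ ($i\in\mathbb I_\tau$); $\mathbf s_{i_1}\cdots\mathbf s_{i_{N_\imath}}$ is a reduced expression of $w_0$ in $W_\tau$ with respect to these generators; and it becomes a reduced expression of $w_0$ in $W$ if each $\mathbf s_{i_k}$ is replaced by $s_{i_k}$ (if $\tau i_k=i_k$) or by $s_{i_k}s_{\tau i_k}$ (if $\tau i_k\ne i_k$). -/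

import Mathlib

open CategoryTheory

universe u

namespace IQuiver

noncomputable section

open scoped Classical in
/-- The Cartan matrix of the underlying graph of a quiver without loops: `c i i = 2`, and for
`i ≠ j`, `- c i j` is the number of arrows connecting `i` and `j`, in either direction. -/
def cartan (V : Type) [Quiver.{0} V] : Matrix V V ℤ :=
  fun i j => if i = j then 2 else -((Nat.card (i ⟶ j) : ℤ) + (Nat.card (j ⟶ i) : ℤ))

/-- A (simply-laced) Dynkin quiver: a finite quiver without oriented cycles whose Cartan matrix is
of finite type, i.e. positive definite. -/
structure IsDynkin (V : Type) [Fintype V] [Quiver.{0} V] : Prop where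
  finite_arrows : ∀ i j : V, Finite (i ⟶ j)
  acyclic : ∀ (i : V) (p : Quiver.Path i i), p.length = 0
  posDef : ((cartan V).map (Int.cast : ℤ → ℝ)).PosDef

/-- An involution of a quiver: a quiver automorphism whose square is the identity. -/
structure Involution (V : Type) [Quiver.{0} V] where
  toPrefunctor : V ⥤q V
  comp_self : toPrefunctor ⋙q toPrefunctor = 𝟭q V

/-- The permutation of the vertices given by an involution of a quiver. -/
def Involution.perm {V : Type} [Quiver.{0} V] (τ : Involution V) : Equiv.Perm V :=
  Function.Involutive.toPerm τ.toPrefunctor.obj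
    (fun i => congrArg (fun F : V ⥤q V => F.obj i) τ.comp_self)

/-- A set of representatives of the `τ`-orbits of vertices. -/
def IsOrbitReps {V : Type} (τ : Equiv.Perm V) (I : Set V) : Prop :=
  ∀ i : V, ∃! j : V, j ∈ I ∧ (j = i ∨ j = τ i)

/-! ### Sinks, reflected quivers and admissible sequences -/

/-- A sink: no arrow starts at `i`. -/
def IsSink {V : Type} (Q : Quiver.{0} V) (i : V) : Prop :=
  ∀ j : V, IsEmpty (Q.Hom i j)

open scoped Classical in
/-- The quiver obtained by reversing all arrows at the vertex `l`
(if `l` is a sink, these are the arrows ending at `l`). -/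
@[reducible]
def reflect {V : Type} (Q : Quiver.{0} V) (l : V) : Quiver.{0} V where
  Hom a b := if a = l ∨ b = l then Q.Hom b a else Q.Hom a b

open scoped Classical in
/-- Reversal of the arrows at `l` and at `τ l`. -/
@[reducible]
def iReflect {V : Type} (τ : Equiv.Perm V) (Q : Quiver.{0} V) (l : V) : Quiver.{0} V :=
  if τ l = l then reflect Q l else reflect (reflect Q (τ l)) l

/-- The sequence `i₁, …, i_t` is `ı`-admissible: each `i_r` is a sink of the quiver
`𝐬_{i_{r-1}} ⋯ 𝐬_{i₁} (Q)`. -/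
def IsIAdmissible {V : Type} (Q : Quiver.{0} V) (τ : Equiv.Perm V) (l : List V) : Prop :=
  ∀ (r : ℕ) (h : r < l.length), IsSink ((l.take r).foldl (iReflect τ) Q) l[r]

/-! ### Root lattice, Weyl group, roots -/

open scoped Classical in
/-- The simple root `α i` in the root lattice `ℤ^V`. -/
def simpleRoot {V : Type} (i : V) : V → ℤ := Pi.single i 1

/-- The `i`-th coroot functional, `x ↦ ∑ j, c i j * x j`, so that `α j ↦ c i j`. -/
def corootForm (V : Type) [Fintype V] [Quiver.{0} V] (i : V) : Module.Dual ℤ (V → ℤ) :=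
  (LinearMap.proj i).comp (cartan V).mulVecLin

lemma corootForm_simpleRoot (V : Type) [Fintype V] [Quiver.{0} V] (i : V) :
    corootForm V i (simpleRoot i) = 2 := by
  classical
  have h : simpleRoot i = (Pi.single i 1 : V → ℤ) := by
    unfold simpleRoot
    congr
  rw [h]
  simp [corootForm, cartan]

/-- The simple reflection `s i`, `x ↦ x - (∑ j, c i j * x j) • α i`, of the root lattice. -/
def simpleRefl (V : Type) [Fintype V] [Quiver.{0} V] (i : V) : (V → ℤ) ≃ₗ[ℤ] (V → ℤ) :=
  Module.reflection (corootForm_simpleRoot V i)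

/-- The Weyl group `W`, generated by the simple reflections. -/
def weylGroup (V : Type) [Fintype V] [Quiver.{0} V] : Subgroup ((V → ℤ) ≃ₗ[ℤ] (V → ℤ)) :=
  Subgroup.closure (Set.range (simpleRefl V))

/-- The set `Φ` of roots: the `W`-orbits of the simple roots. -/
def roots (V : Type) [Fintype V] [Quiver.{0} V] : Set (V → ℤ) :=
  {β | ∃ w ∈ weylGroup V, ∃ i : V, w (simpleRoot i) = β}

/-- The set `Φ⁺` of positive roots. -/
def posRoots (V : Type) [Fintype V] [Quiver.{0} V] : Set (V → ℤ) :=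
  {β | β ∈ roots V ∧ ∀ i, 0 ≤ β i}

/-- The action of `τ` on the root lattice, `∑ a_i α_i ↦ ∑ a_i α_{τ i}`. -/
def latticePerm {V : Type} (τ : Equiv.Perm V) : (V → ℤ) ≃ₗ[ℤ] (V → ℤ) :=
  LinearEquiv.funCongrLeft ℤ ℤ τ.symm

/-- The subgroup `W_τ` of the elements of the Weyl group which commute with `τ`. -/
def restrictedWeylGroup (V : Type) [Fintype V] [Quiver.{0} V] (τ : Equiv.Perm V) :
    Subgroup ((V → ℤ) ≃ₗ[ℤ] (V → ℤ)) :=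
  weylGroup V ⊓ Subgroup.centralizer {latticePerm τ}

open scoped Classical in
/-- The simple reflections `𝐬 i` of the restricted Weyl group. -/
def iRefl (V : Type) [Fintype V] [Quiver.{0} V] (τ : Equiv.Perm V) (i : V) :
    (V → ℤ) ≃ₗ[ℤ] (V → ℤ) :=
  if τ i = i then simpleRefl V i else simpleRefl V i * simpleRefl V (τ i)

/-! ### Reduced expressions and longest elements -/

/-- `l` is a reduced expression of `w` in the generators `s`: it is an expression of `w`, and no
expression of `w` is shorter. -/
def IsReducedExpr {G J : Type} [Group G] (s : J → G) (l : List J) (w : G) : Prop :=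
  (l.map s).prod = w ∧ ∀ l' : List J, (l'.map s).prod = w → l.length ≤ l'.length

/-- `w` is an element of maximal length of the group `H` with respect to the generators `s`. -/
def IsLongestElement {G J : Type} [Group G] (H : Subgroup G) (s : J → G) (w : G) : Prop :=
  w ∈ H ∧ ∃ l : List J, IsReducedExpr s l w ∧
    ∀ g ∈ H, ∃ l' : List J, IsReducedExpr s l' g ∧ l'.length ≤ l.length

/-! ### The roots and the word attached to a sequence of vertices -/

/-- The element `β_j = 𝐬_{i₁} ⋯ 𝐬_{i_{j-1}} (α_{i_j})`, with `j` counted from `0`. -/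
def beta {V : Type} [Fintype V] [Quiver.{0} V] (τ : Equiv.Perm V) (l : List V)
    (j : Fin l.length) : V → ℤ :=
  ((l.take j).map (iRefl V τ)).prod (simpleRoot l[j])

open scoped Classical in
/-- The list `β₁, τ β₁, β₂, τ β₂, …`, where `τ β_j` is omitted if it equals `β_j`. -/
def betaList {V : Type} [Fintype V] [Quiver.{0} V] (τ : Equiv.Perm V) (l : List V) :
    List (V → ℤ) :=
  (List.finRange l.length).flatMap fun j =>
    if latticePerm τ (beta τ l j) = beta τ l j then [beta τ l j]
    else [beta τ l j, latticePerm τ (beta τ l j)]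

open scoped Classical in
/-- The word in the simple reflections of `W` obtained by replacing each `𝐬 i` by `s i`
if `τ i = i` and by `s i, s (τ i)` otherwise. -/
def expand {V : Type} (τ : Equiv.Perm V) (l : List V) : List V :=
  l.flatMap fun i => if τ i = i then [i] else [i, τ i]

/-! ### Representations of a quiver -/

/-- The category of representations over `k` of a quiver with vertices `V`
(equivalently, of modules over its path algebra if `V` is finite). -/
abbrev Rep (k : Type u) [Field k] (V : Type) [Quiver.{0} V] :=
  Paths V ⥤ ModuleCat.{u} k

instance hasExtRep (k : Type u) [Field k] (V : Type) [Quiver.{0} V] :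
    HasExt.{u + 1} (Rep k V) :=
  HasExt.standard (Rep k V)

/-- `M` is a finite-dimensional indecomposable representation with dimension vector `β`. -/
structure IsIndecOfDim {k : Type u} [Field k] {V : Type} [Quiver.{0} V]
    (M : Rep k V) (β : V → ℤ) : Prop where
  indecomposable : Indecomposable M
  finite : ∀ i : V, Module.Finite k (M.obj ((Paths.of V).obj i))
  dim : ∀ i : V, (Module.finrank k (M.obj ((Paths.of V).obj i)) : ℤ) = β i

/-- The list `L` is a `Q`-admissible ordering of the positive roots, with `k` as base field. The
representation `M(β)` is the indecomposable one with dimension vector `β`. -/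
def IsQAdmissible (k : Type u) [Field k] (V : Type) [Fintype V] [Quiver.{0} V]
    (L : List (V → ℤ)) : Prop :=
  L.Nodup ∧ (∀ β, β ∈ L ↔ β ∈ posRoots V) ∧
    ∀ (r t : Fin L.length) (M N : Rep k V), IsIndecOfDim M L[r] → IsIndecOfDim N L[t] →
      (Nontrivial (M ⟶ N) → r ≤ t) ∧ (Nontrivial (Abelian.Ext.{u + 1} M N 1) → t < r)

end

end IQuiver

/-! The proof has a representation-theoretic half and a combinatorial half, joined by the Euler form
⟨x, y⟩, which computes dim Hom − dim Ext¹ on dimension vectors.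

Representations. `Rep.coboundary` is a two-term complex with kernel Hom and cokernel Ext¹, so Ext¹
is right exact in both variables. Positive definiteness and Ringel's lemma show that an
indecomposable M has no self-extensions and satisfies ⟨dim M, dim M⟩ = 1
(`Rep.extVanishes_self_and_eulerForm_eq_one`). A nonzero map M ⟶ N then passes through an
indecomposable summand X of its image with ⟨M, X⟩ > 0 and ⟨X, N⟩ > 0, while a non-split extension of
M by N gives nonzero maps N ⟶ X ⟶ M with X indecomposable. Hence an ordering is Q-admissible, over
every field, as soon as ⟨γ_r, γ_t⟩ > 0 forces r ≤ t (`isQAdmissible_of_eulerForm`). The existence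
and uniqueness of M(β) are not needed.

Combinatorics. The sequence is built greedily, without knowing w₀. Let w be the word built so far.
Reversing the arrows at an orbit of sinks changes the Euler form by the isometry 𝐬_i, so the Euler
form of the current quiver is ⟨w x, w y⟩. The listed roots are the positive roots w y with y
negative, and both they and the roots still missing pair nonpositively with the earlier listed roots
(`IsAdapted`). If a root is missing, the vertices j with w α_j positive form a nonempty set closed
under arrows, so positive definiteness yields a sink there (`IsAdapted.exists_next`), and appending
its representative keeps the invariants (`IsAdapted.append_singleton`). Inversions bound the length,
so the process stops with w sending every positive root to a negative one.

Lengths. Right multiplication by 𝐬_i changes the number of τ-orbits of inversions by exactly one, so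
this number is the length in W_τ. The identity is an allowed involution, for which W_τ = W; both
groups are thus treated by the same lemmas. -/

namespace IQuiver
noncomputable section

/-! ### Representations and the two-term complex computing Hom and Ext¹. -/

namespace Rep

variable {k : Type u} [Field k] {V : Type} [Quiver.{0} V]

/-- The space of a representation at a vertex. -/
abbrev vert (M : Rep k V) (i : V) : ModuleCat.{u} k := M.obj ((Paths.of V).obj i)

/-- The linear map of a representation along an arrow. -/
abbrev arr (M : Rep k V) {i j : V} (a : i ⟶ j) : M.vert i →ₗ[k] M.vert j :=
  (M.map ((Paths.of V).map a)).hom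

/-- The component of a morphism of representations at a vertex. -/
abbrev comp {M N : Rep k V} (f : M ⟶ N) (i : V) : M.vert i →ₗ[k] N.vert i :=
  (f.app ((Paths.of V).obj i)).hom

lemma arr_comp {M N : Rep k V} (f : M ⟶ N) {i j : V} (a : i ⟶ j) :
    N.arr a ∘ₗ comp f i = comp f j ∘ₗ M.arr a := by
  have := f.naturality ((Paths.of V).map a)
  exact (congrArg ModuleCat.Hom.hom this).symm

lemma hom_ext {M N : Rep k V} {f g : M ⟶ N} (h : ∀ i, comp f i = comp g i) : f = g := by
  ext i : 2
  exact ModuleCat.hom_ext (h i)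

/-- A morphism of representations from a compatible family of linear maps. -/
def mkHom {M N : Rep k V} (φ : ∀ i : V, M.vert i →ₗ[k] N.vert i)
    (h : ∀ {i j : V} (a : i ⟶ j), N.arr a ∘ₗ φ i = φ j ∘ₗ M.arr a) : M ⟶ N where
  app i := ModuleCat.ofHom (φ i)
  naturality := by
    intro x y f
    refine Paths.induction (P := fun {x y} f =>
      M.map f ≫ ModuleCat.ofHom (φ y) = ModuleCat.ofHom (φ x) ≫ N.map f) ?_ ?_ f
    · intro v
      erw [M.map_id, N.map_id, Category.id_comp]
    · intro x y z p q hp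
      have hq : M.map ((Paths.of V).map q) ≫ ModuleCat.ofHom (φ z) =
          ModuleCat.ofHom (φ y) ≫ N.map ((Paths.of V).map q) :=
        ModuleCat.hom_ext (h q).symm
      erw [Functor.map_comp, Functor.map_comp, Category.assoc, hq, ← Category.assoc, hp,
        Category.assoc]

@[simp]
lemma comp_mkHom {M N : Rep k V} (φ : ∀ i : V, M.vert i →ₗ[k] N.vert i)
    (h : ∀ {i j : V} (a : i ⟶ j), N.arr a ∘ₗ φ i = φ j ∘ₗ M.arr a) (i : V) :
    comp (mkHom φ h) i = φ i := rfl

@[simp]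
lemma comp_comp {M N P : Rep k V} (f : M ⟶ N) (g : N ⟶ P) (i : V) :
    comp (f ≫ g) i = comp g i ∘ₗ comp f i := rfl

@[simp]
lemma comp_zero (M N : Rep k V) (i : V) : comp (0 : M ⟶ N) i = 0 := rfl

lemma injective_of_mono {M N : Rep k V} (f : M ⟶ N) [Mono f] (i : V) :
    Function.Injective (comp f i) :=
  (ModuleCat.mono_iff_injective _).1 inferInstance

lemma surjective_of_epi {M N : Rep k V} (f : M ⟶ N) [Epi f] (i : V) :
    Function.Surjective (comp f i) :=
  (ModuleCat.epi_iff_surjective _).1 inferInstance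

lemma mono_of_injective {M N : Rep k V} (f : M ⟶ N) (h : ∀ i, Function.Injective (comp f i)) :
    Mono f := by
  rw [NatTrans.mono_iff_mono_app]
  exact fun i => (ModuleCat.mono_iff_injective _).2 (h i)

lemma epi_of_surjective {M N : Rep k V} (f : M ⟶ N) (h : ∀ i, Function.Surjective (comp f i)) :
    Epi f := by
  rw [NatTrans.epi_iff_epi_app]
  exact fun i => (ModuleCat.epi_iff_surjective _).2 (h i)

variable (V) in
/-- The type of all arrows of a quiver. -/
abbrev Arrow := Σ i : V, Σ j : V, (i ⟶ j)

/-- The linear map whose kernel is `Hom(M, N)` and whose cokernel is `Ext¹(M, N)`. -/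
def coboundary (M N : Rep k V) :
    (∀ i : V, M.vert i →ₗ[k] N.vert i) →ₗ[k]
      (∀ a : Arrow V, M.vert a.1 →ₗ[k] N.vert a.2.1) where
  toFun φ a := N.arr a.2.2 ∘ₗ φ a.1 - φ a.2.1 ∘ₗ M.arr a.2.2
  map_add' φ ψ := by
    funext a
    simp only [Pi.add_apply, LinearMap.comp_add, LinearMap.add_comp]
    abel
  map_smul' c φ := by
    funext a
    simp only [Pi.smul_apply, LinearMap.comp_smul, LinearMap.smul_comp, RingHom.id_apply,
      smul_sub]

lemma coboundary_apply (M N : Rep k V) (φ : ∀ i : V, M.vert i →ₗ[k] N.vert i) (a : Arrow V) :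
    coboundary M N φ a = N.arr a.2.2 ∘ₗ φ a.1 - φ a.2.1 ∘ₗ M.arr a.2.2 := rfl

/-- Morphisms of representations are the kernel of the coboundary map. -/
def homEquivKer (M N : Rep k V) : (M ⟶ N) ≃ₗ[k] LinearMap.ker (coboundary M N) where
  toFun f := ⟨fun i => comp f i, by
    rw [LinearMap.mem_ker]
    funext a
    rw [coboundary_apply, arr_comp, sub_self]
    rfl⟩
  map_add' _ _ := rfl
  map_smul' _ _ := rfl
  invFun φ := mkHom φ.1 fun {i j} a => sub_eq_zero.1 (congrFun φ.2 ⟨i, j, a⟩)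
  left_inv f := hom_ext fun i => rfl
  right_inv φ := rfl

/-- `Ext¹(M, N) = 0`, expressed through the coboundary map. -/
def ExtVanishes (M N : Rep k V) : Prop := Function.Surjective (coboundary M N)

/-- Cochains on arrows satisfy no condition, so one on M' extends to M by vertexwise linear
retractions, and a solution on M restricts to M'. This is the vanishing of Ext². -/
lemma ExtVanishes.of_mono {M M' N : Rep k V} (h : ExtVanishes M N) (f : M' ⟶ M) [Mono f] :
    ExtVanishes M' N := by
  intro η
  have hr : ∀ i, ∃ r : M.vert i →ₗ[k] M'.vert i, r ∘ₗ comp f i = LinearMap.id := fun i =>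
    LinearMap.exists_leftInverse_of_injective _ (LinearMap.ker_eq_bot.2 (injective_of_mono f i))
  choose r hr using hr
  obtain ⟨φ, hφ⟩ := h fun a => η a ∘ₗ r a.1
  refine ⟨fun i => φ i ∘ₗ comp f i, ?_⟩
  funext a
  have := congrFun hφ a
  rw [coboundary_apply] at this ⊢
  rw [LinearMap.comp_assoc, ← arr_comp, ← LinearMap.comp_assoc,
    ← LinearMap.comp_assoc, ← LinearMap.sub_comp, this, LinearMap.comp_assoc, hr,
    LinearMap.comp_id]

/-- Dual to `ExtVanishes.of_mono`: cochains lift along vertexwise linear sections. -/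
lemma ExtVanishes.of_epi {M N N' : Rep k V} (h : ExtVanishes M N) (f : N ⟶ N') [Epi f] :
    ExtVanishes M N' := by
  intro η
  have hr : ∀ i, ∃ r : N'.vert i →ₗ[k] N.vert i, comp f i ∘ₗ r = LinearMap.id := fun i =>
    LinearMap.exists_rightInverse_of_surjective _
      (LinearMap.range_eq_top.2 (surjective_of_epi f i))
  choose r hr using hr
  obtain ⟨φ, hφ⟩ := h fun a => r a.2.1 ∘ₗ η a
  refine ⟨fun i => comp f i ∘ₗ φ i, ?_⟩
  funext a
  have := congrFun hφ a
  rw [coboundary_apply] at this ⊢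
  rw [← LinearMap.comp_assoc, arr_comp, LinearMap.comp_assoc, LinearMap.comp_assoc,
    ← LinearMap.comp_sub, this, ← LinearMap.comp_assoc, hr, LinearMap.id_comp]

lemma exists_of_exact {S : ShortComplex (Rep k V)} (hS : S.Exact) (i : V) (x : S.X₂.vert i)
    (hx : comp S.g i x = 0) : ∃ y, comp S.f i y = x := by
  have := hS.map ((evaluation (Paths V) (ModuleCat.{u} k)).obj ((Paths.of V).obj i))
  rw [ShortComplex.moduleCat_exact_iff] at this
  exact this x hx

/-- If `Ext¹(C, N) = 0`, morphisms to `N` extend along a monomorphism with cokernel `C`. -/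
lemma ExtVanishes.exists_extension {S : ShortComplex (Rep k V)} (hS : S.ShortExact) {N : Rep k V}
    (h : ExtVanishes S.X₃ N) (φ : S.X₁ ⟶ N) : ∃ ψ : S.X₂ ⟶ N, S.f ≫ ψ = φ := by
  have := hS.mono_f
  have := hS.epi_g
  have hr : ∀ i, ∃ r : S.X₂.vert i →ₗ[k] S.X₁.vert i, r ∘ₗ comp S.f i = LinearMap.id := fun i =>
    LinearMap.exists_leftInverse_of_injective _ (LinearMap.ker_eq_bot.2 (injective_of_mono S.f i))
  have hs : ∀ i, ∃ s : S.X₃.vert i →ₗ[k] S.X₂.vert i, comp S.g i ∘ₗ s = LinearMap.id := fun i =>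
    LinearMap.exists_rightInverse_of_surjective _
      (LinearMap.range_eq_top.2 (surjective_of_epi S.g i))
  choose r hr using hr
  choose s hs using hs
  -- θ extends φ vertexwise only. Its coboundary vanishes on the subobject, where θ is a morphism,
  -- so it comes from a cochain on the quotient; writing that cochain as the coboundary of γ, the
  -- correction θ − γ ∘ g is a morphism.
  obtain ⟨θ, hθ⟩ : ∃ θ : ∀ i, S.X₂.vert i →ₗ[k] N.vert i, ∀ i, θ i ∘ₗ comp S.f i = comp φ i :=
    ⟨fun i => comp φ i ∘ₗ r i, fun i => by rw [LinearMap.comp_assoc, hr, LinearMap.comp_id]⟩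
  have hzero : ∀ a : Arrow V, coboundary S.X₂ N θ a ∘ₗ comp S.f a.1 = 0 := fun a => by
    rw [coboundary_apply, LinearMap.sub_comp, LinearMap.comp_assoc, hθ, LinearMap.comp_assoc (comp S.f a.1),
      arr_comp S.f, ← LinearMap.comp_assoc, hθ, arr_comp, sub_self]
  have hfac : ∀ a : Arrow V, coboundary S.X₂ N θ a =
      coboundary S.X₂ N θ a ∘ₗ s a.1 ∘ₗ comp S.g a.1 := fun a => by
    ext x
    obtain ⟨y, hy⟩ := exists_of_exact hS.exact a.1 (x - s a.1 (comp S.g a.1 x)) (by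
      rw [map_sub]
      exact sub_eq_zero.2 (LinearMap.congr_fun (hs a.1) _).symm)
    have := LinearMap.congr_fun (hzero a) y
    rw [LinearMap.comp_apply, hy, map_sub] at this
    exact sub_eq_zero.1 this
  obtain ⟨γ, hγ⟩ := h fun a => coboundary S.X₂ N θ a ∘ₗ s a.1
  have hcomm : ∀ {i j : V} (a : i ⟶ j), N.arr a ∘ₗ (θ i - γ i ∘ₗ comp S.g i) =
      (θ j - γ j ∘ₗ comp S.g j) ∘ₗ S.X₂.arr a := by
    intro i j a
    have h1 := hfac ⟨i, j, a⟩
    have h2 := congrFun hγ ⟨i, j, a⟩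
    simp only [coboundary_apply] at h1 h2
    rw [← LinearMap.comp_assoc, ← h2, LinearMap.sub_comp] at h1
    rw [LinearMap.comp_sub, LinearMap.sub_comp, sub_eq_sub_iff_sub_eq_sub, h1,
      LinearMap.comp_assoc, LinearMap.comp_assoc, LinearMap.comp_assoc, arr_comp]
  · refine ⟨mkHom (fun i => θ i - γ i ∘ₗ comp S.g i) hcomm, hom_ext fun i => ?_⟩
    rw [comp_comp, comp_mkHom, LinearMap.sub_comp, hθ, LinearMap.comp_assoc, ← comp_comp, S.zero,
      comp_zero, LinearMap.comp_zero, sub_zero]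

/-! ### Dimension vectors and the Euler form -/

/-- The dimension vector of a representation. -/
def dimVec (M : Rep k V) (i : V) : ℤ := Module.finrank k (M.vert i)

/-- A representation which is finite-dimensional at each vertex. -/
class IsFin (M : Rep k V) : Prop where
  finite : ∀ i : V, Module.Finite k (M.vert i)

instance (M : Rep k V) [h : IsFin M] (i : V) : Module.Finite k (M.vert i) := h.finite i

lemma IsFin.of_mono {M N : Rep k V} (f : M ⟶ N) [Mono f] [IsFin N] : IsFin M :=
  ⟨fun i => Module.Finite.of_injective _ (injective_of_mono f i)⟩

lemma dimVec_nonneg (M : Rep k V) (i : V) : 0 ≤ dimVec M i := Int.natCast_nonneg _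

lemma dimVec_le_of_mono {M N : Rep k V} (f : M ⟶ N) [Mono f] [IsFin N] (i : V) :
    dimVec M i ≤ dimVec N i :=
  Int.ofNat_le.2 (LinearMap.finrank_le_finrank_of_injective (injective_of_mono f i))

lemma epi_of_mono_of_dimVec {M N : Rep k V} (f : M ⟶ N) [Mono f] [IsFin N]
    (h : ∀ i, dimVec N i ≤ dimVec M i) : Epi f := by
  have := IsFin.of_mono f
  refine epi_of_surjective f fun i => ?_
  have hi := injective_of_mono f i
  refine (LinearMap.injective_iff_surjective_of_finrank_eq_finrank ?_).1 hi
  exact le_antisymm (LinearMap.finrank_le_finrank_of_injective hi) (Int.ofNat_le.1 (h i))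

lemma dimVec_shortExact {S : ShortComplex (Rep k V)} (hS : S.ShortExact) [IsFin S.X₂] (i : V) :
    dimVec S.X₂ i = dimVec S.X₁ i + dimVec S.X₃ i := by
  have := hS.mono_f
  have := hS.epi_g
  have h1 := LinearMap.finrank_range_add_finrank_ker (comp S.g i)
  rw [LinearMap.range_eq_top.2 (surjective_of_epi S.g i), finrank_top] at h1
  have h2 : LinearMap.ker (comp S.g i) = LinearMap.range (comp S.f i) := by
    ext x
    refine ⟨exists_of_exact hS.exact i x, ?_⟩
    rintro ⟨y, rfl⟩
    rw [LinearMap.mem_ker, ← LinearMap.comp_apply, ← comp_comp, S.zero]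
    rfl
  rw [h2, LinearMap.finrank_range_of_inj (injective_of_mono S.f i)] at h1
  unfold dimVec
  lia

lemma isZero_of_dimVec {M : Rep k V} [IsFin M] (h : ∀ i, dimVec M i = 0) :
    Limits.IsZero M := by
  rw [Limits.IsZero.iff_id_eq_zero]
  refine hom_ext fun i => ?_
  have : Subsingleton (M.vert i) := Module.finrank_zero_iff.1 (Int.natCast_eq_zero.1 (h i))
  ext x
  exact Subsingleton.elim _ _

variable [Fintype V]

/-- The total dimension of a representation. -/
def totalDim (M : Rep k V) : ℕ := ∑ i, Module.finrank k (M.vert i)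

lemma totalDim_eq (M : Rep k V) : (totalDim M : ℤ) = ∑ i, dimVec M i := by
  simp [totalDim, dimVec]

lemma isZero_of_totalDim {M : Rep k V} [IsFin M] (h : totalDim M = 0) : Limits.IsZero M := by
  refine isZero_of_dimVec fun i => ?_
  rw [totalDim, Finset.sum_eq_zero_iff] at h
  exact Int.natCast_eq_zero.2 (h i (Finset.mem_univ i))

lemma totalDim_shortExact {S : ShortComplex (Rep k V)} (hS : S.ShortExact) [IsFin S.X₂] :
    totalDim S.X₂ = totalDim S.X₁ + totalDim S.X₃ := by
  zify
  simp only [totalDim_eq, dimVec_shortExact hS, Finset.sum_add_distrib]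

lemma totalDim_le_of_mono {M N : Rep k V} (f : M ⟶ N) [Mono f] [IsFin N] :
    totalDim M ≤ totalDim N := by
  zify
  simp only [totalDim_eq]
  exact Finset.sum_le_sum fun i _ => dimVec_le_of_mono f i

lemma epi_of_mono_of_totalDim {M N : Rep k V} (f : M ⟶ N) [Mono f] [IsFin N]
    (h : totalDim N ≤ totalDim M) : Epi f := by
  refine epi_of_mono_of_dimVec f fun i => ?_
  zify at h
  simp only [totalDim_eq] at h
  have := (Finset.sum_eq_sum_iff_of_le fun i _ => dimVec_le_of_mono f i).1
    (le_antisymm (Finset.sum_le_sum fun i _ => dimVec_le_of_mono f i) h)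
  exact (this i (Finset.mem_univ i)).ge

end Rep

/-- The Euler form of a quiver. -/
def eulerForm (V : Type) [Fintype V] [Quiver.{0} V] (x y : V → ℤ) : ℤ :=
  ∑ i, x i * y i - ∑ i, ∑ j, (Nat.card (i ⟶ j) : ℤ) * (x i * y j)

namespace Rep

variable {k : Type u} [Field k] {V : Type} [Quiver.{0} V] [Fintype V]

instance (M N : Rep k V) [IsFin M] [IsFin N] : Module.Finite k (M ⟶ N) :=
  Module.Finite.equiv (homEquivKer M N).symm

section

variable [hfin : ∀ i j : V, Finite (i ⟶ j)] (M N : Rep k V) [IsFin M] [IsFin N]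

/-- The Euler form is the Euler characteristic of the two-term complex, so rank-nullity for
`coboundary` compares it with dim Hom. -/
lemma eulerForm_dimVec :
    eulerForm V (dimVec M) (dimVec N) =
      Module.finrank k (∀ i : V, M.vert i →ₗ[k] N.vert i) -
      Module.finrank k (∀ a : Arrow V, M.vert a.1 →ₗ[k] N.vert a.2.1) := by
  have : ∀ i j : V, Fintype (i ⟶ j) := fun i j => Fintype.ofFinite _
  have h1 : Module.finrank k (∀ i : V, M.vert i →ₗ[k] N.vert i) =
      ∑ i, Module.finrank k (M.vert i) * Module.finrank k (N.vert i) := by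
    rw [Module.finrank_pi_fintype]
    exact Finset.sum_congr rfl fun i _ => Module.finrank_linearMap ..
  have h2 : Module.finrank k (∀ a : Arrow V, M.vert a.1 →ₗ[k] N.vert a.2.1) =
      ∑ i, ∑ j, Nat.card (i ⟶ j) * (Module.finrank k (M.vert i) * Module.finrank k (N.vert j)) := by
    rw [Module.finrank_pi_fintype, Fintype.sum_sigma]
    refine Finset.sum_congr rfl fun i _ => ?_
    rw [Fintype.sum_sigma]
    refine Finset.sum_congr rfl fun j _ => ?_
    trans ∑ a : i ⟶ j, Module.finrank k (M.vert i) * Module.finrank k (N.vert j)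
    · exact Finset.sum_congr rfl fun a _ => Module.finrank_linearMap ..
    · rw [Finset.sum_const, Finset.card_univ, Nat.card_eq_fintype_card, smul_eq_mul]
  rw [h1, h2]
  push_cast
  rfl

lemma eulerForm_le_finrank_hom :
    eulerForm V (dimVec M) (dimVec N) ≤ Module.finrank k (M ⟶ N) := by
  have h1 := LinearMap.finrank_range_add_finrank_ker (coboundary M N)
  have h2 := Submodule.finrank_le (LinearMap.range (coboundary M N))
  rw [eulerForm_dimVec, (homEquivKer M N).finrank_eq]
  lia

lemma extVanishes_iff :
    ExtVanishes M N ↔ eulerForm V (dimVec M) (dimVec N) = Module.finrank k (M ⟶ N) := by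
  have h1 := LinearMap.finrank_range_add_finrank_ker (coboundary M N)
  rw [eulerForm_dimVec, (homEquivKer M N).finrank_eq, ExtVanishes, ← LinearMap.range_eq_top]
  constructor
  · intro h
    rw [h, finrank_top] at h1
    lia
  · intro h
    apply Submodule.eq_top_of_finrank_eq
    lia

variable {M N}

lemma ExtVanishes.eulerForm_pos (h : ExtVanishes M N) (f : M ⟶ N) (hf : f ≠ 0) :
    0 < eulerForm V (dimVec M) (dimVec N) := by
  rw [(extVanishes_iff M N).1 h]
  have : Nontrivial (M ⟶ N) := ⟨f, 0, hf⟩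
  exact_mod_cast Module.finrank_pos

end

end Rep

/-! ### Indecomposable objects, idempotents and Fitting's lemma. -/

open Limits

/-- A retract of an indecomposable object of an abelian category is zero or the whole object. -/
lemma isZero_or_isIso_of_retract {C : Type*} [Category* C] [Abelian C] {X K : C}
    (hX : Indecomposable X) (i : K ⟶ X) (p : X ⟶ K) (h : i ≫ p = 𝟙 K) : IsZero K ∨ IsIso i := by
  have : Mono i := mono_of_mono_fac h
  let S : ShortComplex C := ShortComplex.mk i (cokernel.π i) (by simp)
  have hS : S.Exact := S.exact_of_g_is_cokernel (cokernelIsCokernel i)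
  have e := (ShortComplex.Splitting.ofExactOfRetraction S hS p h inferInstance).isoBinaryBiproduct
  refine (hX.2 _ _ e).imp id fun hz => ?_
  have : Epi i := Preadditive.epi_of_cokernel_zero (hz.eq_of_tgt _ _)
  exact isIso_of_mono_of_epi i

lemma eq_zero_or_one_of_idem {C : Type*} [Category* C] [Abelian C] {X : C}
    (hX : Indecomposable X) (e : End X) (he : e * e = e) : e = 0 ∨ e = 1 := by
  obtain ⟨K, i, p, hip, hpi⟩ := IsIdempotentComplete.idempotents_split X e he
  obtain h | h := isZero_or_isIso_of_retract hX i p hip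
  · left
    rw [← hpi, h.eq_of_tgt p 0, zero_comp]
  · right
    rw [← hpi]
    have : p = inv i := by rw [← cancel_epi i, hip, IsIso.hom_inv_id]
    rw [this, IsIso.inv_hom_id]
    rfl

/-- Fitting's lemma: if a finite-dimensional algebra has only trivial idempotents, each of its
elements is invertible or nilpotent. -/
lemma isUnit_or_isNilpotent {k A : Type*} [Field k] [Ring A] [Algebra k A] [Module.Finite k A]
    (h : ∀ e : A, e * e = e → e = 0 ∨ e = 1) (a : A) : IsUnit a ∨ IsNilpotent a := by
  obtain ⟨n, hn⟩ := Filter.eventually_atTop.1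
    (LinearMap.mulLeft k a).eventually_isCompl_ker_pow_range_pow
  have hc := hn (n + 1) (Nat.le_succ n)
  rw [LinearMap.pow_mulLeft] at hc
  set x := a ^ (n + 1) with hx
  -- Split 1 = e + f along kernel ⊕ image of multiplication by x. The product e f = f (1 − f) lies
  -- in both summands, so it vanishes and f is idempotent.
  obtain ⟨e, he, f, ⟨b, hb⟩, hef⟩ := Submodule.mem_sup.1 (hc.sup_eq_top ▸ Submodule.mem_top (x := (1 : A)))
  rw [LinearMap.mem_ker, LinearMap.mulLeft_apply] at he
  rw [LinearMap.mulLeft_apply] at hb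
  have hker : e * f ∈ LinearMap.ker (LinearMap.mulLeft k x) := by
    rw [LinearMap.mem_ker, LinearMap.mulLeft_apply, ← mul_assoc, he, zero_mul]
  have hran : e * f ∈ LinearMap.range (LinearMap.mulLeft k x) :=
    ⟨b * (1 - f), by
      rw [LinearMap.mulLeft_apply, ← mul_assoc, hb, eq_sub_of_add_eq hef]; noncomm_ring⟩
  have h0 : e * f = 0 := (Submodule.disjoint_def.1 hc.disjoint) _ hker hran
  have hff : f * f = f := by
    have := congrArg (· * f) hef
    simpa [add_mul, h0] using this
  obtain rfl | rfl := h f hff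
  · right
    refine ⟨n + 1, ?_⟩
    rw [← hx]
    rw [add_zero] at hef
    rw [← mul_one x, ← hef, he]
  · left
    have hr : a * (a ^ n * b) = 1 := by rw [← mul_assoc, ← pow_succ', ← hx, hb]
    -- In an artinian ring a one-sided inverse is two-sided.
    have : IsArtinianRing A := isArtinian_of_tower k inferInstance
    exact IsUnit.of_mul_eq_one _ hr

namespace Rep

variable {k : Type u} [Field k] {V : Type} [Quiver.{0} V] [Fintype V]

lemma totalDim_lt_of_mono {M N : Rep k V} (f : M ⟶ N) [Mono f] [IsFin N] (h : ¬ Epi f) :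
    totalDim M < totalDim N :=
  lt_of_not_ge fun hle => h (epi_of_mono_of_totalDim f hle)

lemma totalDim_lt_of_iso_biprod {M Y Z : Rep k V} [IsFin M] (e : M ≅ Y ⊞ Z) (hZ : ¬ IsZero Z) :
    totalDim Y < totalDim M := by
  refine totalDim_lt_of_mono (biprod.inl ≫ e.inv) fun hepi => hZ ?_
  have h : (biprod.inl ≫ e.inv) ≫ e.hom ≫ (biprod.snd : Y ⊞ Z ⟶ Z) = 0 := by simp
  have h1 : e.hom ≫ (biprod.snd : Y ⊞ Z ⟶ Z) = 0 := zero_of_epi_comp _ h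
  have h2 : (biprod.snd : Y ⊞ Z ⟶ Z) = 0 := zero_of_epi_comp _ h1
  exact IsZero.of_epi_eq_zero _ h2

/-- If, for each indecomposable direct summand `X` of `E`, one of the components `N ⟶ X` of `f`
and `X ⟶ M` of `g` vanishes, then there is an endomorphism of `E` which fixes `f` and kills
`g`. -/
lemma exists_end_of_summands {N M : Rep k V} :
    ∀ (E : Rep k V) [IsFin E] (f : N ⟶ E) (g : E ⟶ M),
      (∀ (X : Rep k V) (i : X ⟶ E) (p : E ⟶ X), i ≫ p = 𝟙 X → Indecomposable X →
        f ≫ p = 0 ∨ i ≫ g = 0) → ∃ e : E ⟶ E, f ≫ e = f ∧ e ≫ g = 0 := by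
  intro E
  induction hn : totalDim E using Nat.strong_induction_on generalizing E with
  | _ n ih =>
  intro hE f g h
  by_cases hz : IsZero E
  · exact ⟨0, hz.eq_of_tgt _ _, zero_comp⟩
  -- On an indecomposable E one of the endomorphisms 0 and 1 works; on Y ⊕ Z a diagonal one is
  -- assembled from the two summands.
  by_cases hi : Indecomposable E
  · obtain h0 | h0 := h E (𝟙 E) (𝟙 E) (by simp) hi
    · exact ⟨0, by simpa using h0.symm, zero_comp⟩
    · exact ⟨𝟙 E, by simp, by simpa using h0⟩
  · simp only [Indecomposable, not_and, not_forall, not_or] at hi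
    obtain ⟨Y, Z, e, hY, hZ⟩ := hi hz
    have hYE : totalDim Y < totalDim E := totalDim_lt_of_iso_biprod e hZ
    have hZE : totalDim Z < totalDim E :=
      totalDim_lt_of_iso_biprod (e ≪≫ biprod.braiding Y Z) hY
    have hfY : IsFin Y := IsFin.of_mono (biprod.inl ≫ e.inv)
    have hfZ : IsFin Z := IsFin.of_mono (biprod.inr ≫ e.inv)
    obtain ⟨a, ha, ha'⟩ := ih _ (hn ▸ hYE) Y rfl (f ≫ e.hom ≫ biprod.fst)
      (biprod.inl ≫ e.inv ≫ g) fun X i p hip hX => by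
        have := h X (i ≫ biprod.inl ≫ e.inv) (e.hom ≫ biprod.fst ≫ p) (by simp [hip]) hX
        simpa using this
    obtain ⟨b, hb, hb'⟩ := ih _ (hn ▸ hZE) Z rfl (f ≫ e.hom ≫ biprod.snd)
      (biprod.inr ≫ e.inv ≫ g) fun X i p hip hX => by
        have := h X (i ≫ biprod.inr ≫ e.inv) (e.hom ≫ biprod.snd ≫ p) (by simp [hip]) hX
        simpa using this
    refine ⟨e.hom ≫ biprod.map a b ≫ e.inv, ?_, ?_⟩
    · rw [← cancel_mono e.hom]
      refine biprod.hom_ext _ _ ?_ ?_ <;> simpa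
    · rw [← cancel_epi e.inv]
      refine biprod.hom_ext' _ _ ?_ ?_ <;> simpa

/-- A nonzero morphism has a nonzero component at some indecomposable summand of its target. -/
lemma exists_summand {N E : Rep k V} [IsFin E] (f : N ⟶ E) (hf : f ≠ 0) :
    ∃ (X : Rep k V) (i : X ⟶ E) (p : E ⟶ X), i ≫ p = 𝟙 X ∧ Indecomposable X ∧ f ≫ p ≠ 0 := by
  by_contra! hcon
  obtain ⟨e, h1, h2⟩ := exists_end_of_summands E f (𝟙 E)
    fun X i p hip hX => Or.inl (hcon X i p hip hX)
  apply hf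
  rw [← h1, ← Category.comp_id e, h2, Limits.comp_zero]

lemma isUnit_or_isNilpotent_end {M : Rep k V} [IsFin M] (hM : Indecomposable M) (θ : End M) :
    IsUnit θ ∨ IsNilpotent θ :=
  haveI : Module.Finite k (End M) := inferInstanceAs (Module.Finite k (M ⟶ M))
  isUnit_or_isNilpotent (k := k) (eq_zero_or_one_of_idem hM) θ

end Rep

open Limits

/-! ### Ringel's lemma and the norm of an indecomposable representation. -/

namespace Rep

variable {k : Type u} [Field k] {V : Type} [Quiver.{0} V]

/-- The endomorphism ring of a representation acts on the space at each vertex. -/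
@[reducible]
def endModule (M : Rep k V) (i : V) : Module (End M) (M.vert i) where
  smul θ x := comp θ i x
  one_smul _ := rfl
  mul_smul _ _ _ := rfl
  smul_zero θ := map_zero (comp θ i)
  smul_add θ := map_add (comp θ i)
  add_smul _ _ _ := rfl
  zero_smul _ := rfl

/-- If each nonzero endomorphism of `M` is invertible, then the dimension of the endomorphism ring
divides each entry of the dimension vector. -/
lemma finrank_end_dvd {M : Rep k V} (h : ∀ θ : End M, θ ≠ 0 → IsUnit θ) (hM : ¬ IsZero M)
    (i : V) : (Module.finrank k (M ⟶ M) : ℤ) ∣ dimVec M i := by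
  have : Nontrivial (End M) := ⟨1, 0, fun h0 => hM ((IsZero.iff_id_eq_zero _).2 h0)⟩
  let : DivisionRing (End M) := DivisionRing.ofIsUnitOrEqZero fun θ => by
    by_cases h0 : θ = 0
    · exact Or.inr h0
    · exact Or.inl (h θ h0)
  let := endModule M i
  have : IsScalarTower k (End M) (M.vert i) := ⟨fun _ _ _ => rfl⟩
  have := Module.finrank_mul_finrank k (End M) (M.vert i)
  exact Int.natCast_dvd_natCast.2 ⟨_, this.symm⟩

variable [Fintype V]

lemma mono_of_epi_of_totalDim {M N : Rep k V} (f : M ⟶ N) [Epi f] [IsFin M]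
    (h : totalDim M ≤ totalDim N) : Mono f := by
  let S : ShortComplex (Rep k V) := ShortComplex.mk (kernel.ι f) f (by simp)
  have hS : S.ShortExact :=
    { exact := S.exact_of_f_is_kernel (kernelIsKernel f)
      mono_f := inferInstanceAs (Mono (kernel.ι f))
      epi_g := inferInstanceAs (Epi f) }
  have hfin : IsFin S.X₂ := inferInstanceAs (IsFin M)
  have h1 : totalDim M = totalDim (kernel f) + totalDim N := totalDim_shortExact hS
  have := IsFin.of_mono (kernel.ι f)
  exact Preadditive.mono_of_isZero_kernel f (isZero_of_totalDim (by lia))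

lemma isUnit_of_mono {M : Rep k V} [IsFin M] (f : M ⟶ M) [Mono f] :
    IsUnit (End.of f) := by
  rw [isUnit_iff_isIso]
  have : Epi f := epi_of_mono_of_totalDim _ le_rfl
  exact isIso_of_mono_of_epi f

/-- Ringel's lemma: if all smaller indecomposable representations have no self-extensions, then
each nonzero endomorphism of an indecomposable representation is invertible. -/
lemma isUnit_end_of_smaller {M : Rep k V} [IsFin M] (hM : Indecomposable M)
    (hs : ∀ (K : Rep k V) [IsFin K], Indecomposable K → totalDim K < totalDim M →
      ExtVanishes K K) (θ : End M) (hθ : θ ≠ 0) : IsUnit θ := by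
  by_contra hu
  -- Among all nonzero non-invertible endomorphisms, choose one whose image I has least dimension.
  let P : ℕ → Prop := fun n => ∃ (I : Rep k V) (e : M ⟶ I) (m : I ⟶ M), Epi e ∧ Mono m ∧
    e ≫ m ≠ 0 ∧ ¬ IsUnit (End.of (e ≫ m)) ∧ totalDim I = n
  have hP : ∃ n, P n := ⟨_, image θ, factorThruImage θ, image.ι θ, inferInstance, inferInstance,
    by rw [image.fac]; exact hθ, by rw [image.fac]; exact hu, rfl⟩
  classical
  obtain ⟨I, e, m, he, hm, hne, hnu, hI⟩ := Nat.find_spec hP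
  have hmin : ∀ n, P n → totalDim I ≤ n := fun n hn => hI ▸ Nat.find_min' hP hn
  have hfinI : IsFin I := IsFin.of_mono m
  have heM : ¬ Mono e := fun h => hnu <| by
    have : Mono (e ≫ m) := mono_comp e m
    exact isUnit_of_mono (e ≫ m)
  -- If h is nonzero, e followed by h and j is again a nonzero non-invertible endomorphism, with
  -- image a quotient of I; minimality makes h injective.
  have key : ∀ {K : Rep k V} (h : I ⟶ K) (j : K ⟶ M) [Mono j], h ≠ 0 →
      ∀ i, Function.Injective (comp h i) := by
    intro K h j hj h0
    have h1 : totalDim I ≤ totalDim (image h) := by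
      refine hmin _ ⟨image h, e ≫ factorThruImage h, image.ι h ≫ j, epi_comp _ _, mono_comp _ _,
        ?_, ?_, rfl⟩
      · intro h2
        rw [Category.assoc, image.fac_assoc] at h2
        have h3 := zero_of_epi_comp e h2
        exact h0 (zero_of_comp_mono j h3)
      · intro h2
        rw [isUnit_iff_isIso] at h2
        have : Mono ((e ≫ factorThruImage h) ≫ image.ι h ≫ j) := inferInstance
        rw [Category.assoc] at this
        exact heM (mono_of_mono e (factorThruImage h ≫ image.ι h ≫ j))
    have := mono_of_epi_of_totalDim (factorThruImage h) h1
    have hmono : Mono (factorThruImage h ≫ image.ι h) := mono_comp _ _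
    rw [image.fac] at hmono
    exact injective_of_mono h
  have hI0 : ¬ IsZero I := fun h => hne (by rw [h.eq_of_tgt e 0, zero_comp])
  -- Otherwise `m ≫ e` is a monic endomorphism of I, and the powers of `e ≫ m` all have the form e,
  -- then a mono, then m. None of them vanishes, against nilpotency.
  have hsq : m ≫ e = 0 := by
    by_contra h0
    have hν : Mono (m ≫ e) := mono_of_injective _ (key (m ≫ e) m h0)
    have hpow : ∀ n : ℕ, ∃ ν : I ⟶ I, Mono ν ∧ e ≫ ν ≫ m = (End.of (e ≫ m)) ^ (n + 1) := by
      intro n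
      induction n with
      | zero => exact ⟨𝟙 I, inferInstance, by simp⟩
      | succ n ih =>
        obtain ⟨ν, hν', h⟩ := ih
        refine ⟨ν ≫ m ≫ e, mono_comp ν (m ≫ e), ?_⟩
        rw [pow_succ', End.mul_def, ← h]
        simp
    obtain ⟨n, hn⟩ := (isUnit_or_isNilpotent_end hM (End.of (e ≫ m))).resolve_left hnu
    obtain ⟨ν, hν', h⟩ := hpow n
    rw [pow_succ, hn, zero_mul] at h
    have h2 : ν = 0 := zero_of_comp_mono m (zero_of_epi_comp e h)
    subst h2
    exact hI0 (IsZero.of_mono_eq_zero (0 : I ⟶ I) rfl)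
  let S : ShortComplex (Rep k V) := ShortComplex.mk (kernel.ι e) e (by simp)
  have hS : S.ShortExact :=
    { exact := S.exact_of_f_is_kernel (kernelIsKernel e)
      mono_f := inferInstanceAs (Mono (kernel.ι e))
      epi_g := inferInstanceAs (Epi e) }
  have hfinK : IsFin (kernel e) := IsFin.of_mono (kernel.ι e)
  have hιe : ¬ Epi (kernel.ι e) := fun h => hne (by
    rw [zero_of_epi_comp _ (kernel.condition e), zero_comp])
  have hl : kernel.lift e m hsq ≠ 0 := fun h => hne (by
    rw [← kernel.lift_ι e m hsq, h, zero_comp, Limits.comp_zero])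
  -- I embeds in ker e, hence by minimality in some indecomposable summand X of ker e. As X is
  -- smaller than M, Ext¹(X, X) = 0, so Ext¹(I, X) = 0 and the projection onto X extends from ker e
  -- to M. Then X is a retract of the indecomposable M although ker e is a proper subobject.
  obtain ⟨X, i, p, hip, hX, hlp⟩ := exists_summand _ hl
  have hi : Mono i := mono_of_mono_fac hip
  have hfinX : IsFin X := IsFin.of_mono i
  have hmono : Mono (kernel.lift e m hsq ≫ p) :=
    mono_of_injective _ (key _ (i ≫ kernel.ι e) hlp)
  have hXM : totalDim X < totalDim M :=
    (totalDim_le_of_mono i).trans_lt (totalDim_lt_of_mono (kernel.ι e) hιe)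
  have hext : ExtVanishes I X := (hs X hX hXM).of_mono (kernel.lift e m hsq ≫ p)
  obtain ⟨ψ, hψ⟩ := ExtVanishes.exists_extension hS (N := X) hext p
  have hψ' : kernel.ι e ≫ ψ = p := hψ
  obtain h | h := isZero_or_isIso_of_retract hM (i ≫ kernel.ι e) ψ
    (by rw [Category.assoc, hψ', hip])
  · exact hX.1 h
  · exact hιe (epi_of_epi i (kernel.ι e))

lemma eulerForm_smul_smul (d : ℤ) (x y : V → ℤ) :
    eulerForm V (d • x) (d • y) = d ^ 2 * eulerForm V x y := by
  simp only [eulerForm, Pi.smul_apply, smul_eq_mul, mul_sub, Finset.mul_sum]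
  congr 1
  · exact Finset.sum_congr rfl fun i _ => by ring
  · exact Finset.sum_congr rfl fun i _ => Finset.sum_congr rfl fun j _ => by ring

variable [hfin : ∀ i j : V, Finite (i ⟶ j)]

/-- Over a quiver with positive definite Euler form, an indecomposable representation has no
self-extensions and its dimension vector has norm one. -/
theorem extVanishes_self_and_eulerForm_eq_one
    (hq : ∀ x : V → ℤ, x ≠ 0 → 0 < eulerForm V x x) :
    ∀ (M : Rep k V) [IsFin M], Indecomposable M →
      ExtVanishes M M ∧ eulerForm V (dimVec M) (dimVec M) = 1 := by
  intro M
  induction hn : totalDim M using Nat.strong_induction_on generalizing M with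
  | _ n ih =>
  intro hfM hM
  have hbrick := isUnit_end_of_smaller hM fun K _ hK hlt => (ih _ (hn ▸ hlt) K rfl hK).1
  set d : ℤ := ((Module.finrank k (M ⟶ M) : ℕ) : ℤ) with hd
  have hdvd : ∀ i, d ∣ dimVec M i := finrank_end_dvd hbrick hM.1
  have : Nontrivial (M ⟶ M) := ⟨𝟙 M, 0, fun h0 => hM.1 ((IsZero.iff_id_eq_zero _).2 h0)⟩
  have hdpos : 0 < d := Int.natCast_pos.2 Module.finrank_pos
  choose x hx using hdvd
  have hx' : dimVec M = d • x := funext hx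
  have hx0 : x ≠ 0 := by
    rintro rfl
    exact hM.1 (isZero_of_dimVec fun i => by rw [hx', smul_zero]; rfl)
  have h1 : eulerForm V (dimVec M) (dimVec M) = d ^ 2 * eulerForm V x x := by
    rw [hx', eulerForm_smul_smul]
  have h2 : eulerForm V (dimVec M) (dimVec M) ≤ d := eulerForm_le_finrank_hom M M
  have h3 := hq x hx0
  -- All entries of the dimension vector are divisible by d = dim End M, so d² ⟨x, x⟩ ≤ d with ⟨x,
  -- x⟩ ≥ 1.
  have hd1 : d = 1 := by nlinarith
  have h4 : eulerForm V (dimVec M) (dimVec M) = 1 := by nlinarith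
  exact ⟨(extVanishes_iff M M).2 (by rw [h4, ← hd, hd1]), h4⟩

/-- A nonzero morphism between indecomposable representations factors through an indecomposable
representation, with positive values of the Euler form. -/
lemma exists_between (hq : ∀ x : V → ℤ, x ≠ 0 → 0 < eulerForm V x x) {M N : Rep k V} [IsFin M]
    [IsFin N] (hM : Indecomposable M) (hN : Indecomposable N) (f : M ⟶ N) (hf : f ≠ 0) :
    ∃ (X : Rep k V) (p : M ⟶ X) (j : X ⟶ N), IsFin X ∧ Indecomposable X ∧ Epi p ∧ Mono j ∧
      0 < eulerForm V (dimVec M) (dimVec X) ∧ 0 < eulerForm V (dimVec X) (dimVec N) := by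
  have hfinI : IsFin (image f) := IsFin.of_mono (image.ι f)
  have h0 : factorThruImage f ≠ 0 := fun h => hf (by rw [← image.fac f, h, zero_comp])
  -- A summand of the image is both a quotient of M and a subobject of N, so Ext¹(M, X) and Ext¹(X,
  -- N) vanish along with the self-extensions of M and N.
  obtain ⟨X, i, p, hip, hX, hp⟩ := exists_summand _ h0
  have hi : Mono i := mono_of_mono_fac hip
  have hpe : Epi p := epi_of_epi_fac hip
  have hfX : IsFin X := IsFin.of_mono i
  have hj : Mono (i ≫ image.ι f) := mono_comp _ _
  have hpe' : Epi (factorThruImage f ≫ p) := epi_comp _ _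
  refine ⟨X, factorThruImage f ≫ p, i ≫ image.ι f, hfX, hX, hpe', hj, ?_, ?_⟩
  · exact ExtVanishes.eulerForm_pos
      ((extVanishes_self_and_eulerForm_eq_one hq M hM).1.of_epi (factorThruImage f ≫ p)) _ hp
  · refine ExtVanishes.eulerForm_pos
      ((extVanishes_self_and_eulerForm_eq_one hq N hN).1.of_mono (i ≫ image.ι f))
      (i ≫ image.ι f) fun h => hX.1 (IsZero.of_mono_eq_zero _ h)

end Rep

/-! ### Non-split extensions and comparison with `Abelian.Ext`. -/

open Limits

/-- A nonzero class in `Ext¹(M, N)` yields a non-split extension of `M` by `N`. -/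
lemma exists_nonsplit_of_ext {C : Type*} [Category* C] [Abelian C] [EnoughInjectives C]
    [HasExt.{u} C] {M N : C} (h : Nontrivial (Abelian.Ext.{u} M N 1)) :
    ∃ (E : C) (i : N ⟶ E) (p : E ⟶ M) (w : i ≫ p = 0), (ShortComplex.mk i p w).ShortExact ∧
      ∀ r : E ⟶ N, i ≫ r ≠ 𝟙 N := by
  obtain ⟨x, hx⟩ := exists_ne (0 : Abelian.Ext.{u} M N 1)
  let ι := Injective.ι N
  let S : ShortComplex C := ShortComplex.mk ι (cokernel.π ι) (by simp)
  have hS : S.ShortExact :=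
    { exact := S.exact_of_g_is_cokernel (cokernelIsCokernel ι)
      mono_f := inferInstanceAs (Mono ι)
      epi_g := inferInstanceAs (Epi (cokernel.π ι)) }
  -- Ext¹ into an injective vanishes, so x is the image under the connecting map of some f from M to
  -- the cokernel of ι. The extension sought is the pullback of S along f.
  obtain ⟨y, hy⟩ := Abelian.Ext.covariant_sequence_exact₁ M hS x
    (Abelian.Ext.eq_zero_of_injective (I := Injective.under N) _) (zero_add 1)
  obtain ⟨f, rfl⟩ := (Abelian.Ext.mk₀_bijective M S.X₃).2 y
  have hepi : Epi S.g := hS.epi_g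
  have hmono : Mono S.f := hS.mono_f
  let T : ShortComplex C := ShortComplex.mk (pullback.lift S.f 0 (S.zero.trans zero_comp.symm) : N ⟶ pullback S.g f)
    (pullback.snd S.g f) (pullback.lift_snd _ _ _)
  have hTf : T.f ≫ pullback.fst S.g f = S.f := pullback.lift_fst _ _ _
  have hTm : Mono T.f := mono_of_mono_fac hTf
  have hT : T.ShortExact :=
    { mono_f := hTm
      epi_g := inferInstanceAs (Epi (pullback.snd S.g f))
      exact := by
        refine T.exact_of_f_is_kernel (KernelFork.IsLimit.ofι' T.f T.zero fun {W} w hw => ?_)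
        have h0 : (w ≫ pullback.fst S.g f) ≫ S.g = 0 := by
          have hw' : w ≫ pullback.snd S.g f = 0 := hw
          rw [Category.assoc, pullback.condition, reassoc_of% hw', zero_comp]
        refine ⟨hS.exact.lift _ h0, ?_⟩
        refine pullback.hom_ext ?_ ?_
        · rw [Category.assoc, hTf, ShortComplex.Exact.lift_f]
        · rw [Category.assoc]
          exact (congrArg _ T.zero).trans (comp_zero.trans hw.symm) }
  refine ⟨T.X₂, T.f, T.g, T.zero, hT, fun r hr => hx ?_⟩
  have hT3 : Epi T.g := hT.epi_g
  have h0 : T.f ≫ (pullback.fst S.g f - r ≫ S.f) = 0 := by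
    rw [Preadditive.comp_sub, hTf, reassoc_of% hr, sub_self]
  have h1 : T.g ≫ hT.exact.desc _ h0 = pullback.fst S.g f - r ≫ S.f := hT.exact.g_desc _ h0
  -- A retraction r would make f factor through S.g, so that the connecting map would kill it.
  have h2 : hT.exact.desc _ h0 ≫ S.g = f := by
    rw [← cancel_epi T.g, reassoc_of% h1, Preadditive.sub_comp, Category.assoc, S.zero, comp_zero,
      sub_zero]
    exact pullback.condition
  rw [← hy, ← h2, ← Abelian.Ext.mk₀_comp_mk₀, Abelian.Ext.comp_assoc_of_second_deg_zero,
    hS.comp_extClass, Abelian.Ext.comp_zero]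

namespace Rep

variable (k : Type u) [Field k] (V : Type) [Quiver.{0} V]

/-- This supplies the enough injectives required by `exists_nonsplit_of_ext`. The passage to the
double opposite presents the category as presheaves, which have a separator. -/
instance : IsGrothendieckAbelian.{u} (Rep k V) where
  ab5OfSize := ⟨fun _ _ _ => inferInstance⟩
  hasSeparator := by
    have : HasSeparator (((Paths V)ᵒᵖ)ᵒᵖ ⥤ ModuleCat.{u} k) := inferInstance
    exact HasSeparator.of_equivalence (Equivalence.congrLeft (opOpEquivalence (Paths V)))

variable {k V}
lemma IsFin.of_shortExact {S : ShortComplex (Rep k V)} (hS : S.ShortExact) [IsFin S.X₁]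
    [IsFin S.X₃] : IsFin S.X₂ := by
  refine ⟨fun i => ?_⟩
  refine Module.Finite.of_exact (f := comp S.f i) (g := comp S.g i) (fun x => ?_)
    (have := hS.epi_g; surjective_of_epi S.g i)
  refine ⟨exists_of_exact hS.exact i x, ?_⟩
  rintro ⟨y, rfl⟩
  rw [← LinearMap.comp_apply, ← comp_comp, S.zero]
  rfl

/-- Solvability of the coboundary equation splits every extension. Only this half of the comparison
between the two notions of Ext¹ is used. -/
lemma not_extVanishes_of_ext {M N : Rep k V} (h : Nontrivial (Abelian.Ext.{u + 1} M N 1)) :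
    ¬ ExtVanishes M N := by
  intro hv
  obtain ⟨E, i, p, w, hS, hr⟩ := exists_nonsplit_of_ext h
  obtain ⟨r, h⟩ := ExtVanishes.exists_extension hS hv (𝟙 N)
  exact hr r h

variable [Fintype V]

/-- If no indecomposable summand of the middle term carried nonzero maps on both sides, an
endomorphism would fix N ⟶ E and kill E ⟶ M. It would factor through N and split the extension. -/
lemma exists_between_of_ext {M N : Rep k V} [IsFin M] [IsFin N]
    (h : Nontrivial (Abelian.Ext.{u + 1} M N 1)) :
    ∃ (X : Rep k V) (f : N ⟶ X) (g : X ⟶ M), IsFin X ∧ Indecomposable X ∧ f ≠ 0 ∧ g ≠ 0 := by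
  by_contra! hcon
  obtain ⟨E, f, g, w, hS, hr⟩ := exists_nonsplit_of_ext h
  have : Mono f := hS.mono_f
  have hfin : IsFin E := IsFin.of_shortExact (S := ShortComplex.mk f g w) hS
  obtain ⟨e, h1, h2⟩ := exists_end_of_summands E f g fun X i p hip hX => by
    have : Mono i := mono_of_mono_fac hip
    by_contra! h0
    exact h0.2 (hcon X (f ≫ p) (i ≫ g) (IsFin.of_mono i) hX h0.1)
  refine hr (hS.exact.lift e h2) ?_
  rw [← cancel_mono f, Category.assoc, Category.id_comp]
  exact (congrArg _ (hS.exact.lift_f e h2)).trans h1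

end Rep

/-- A list containing all positive vectors of norm one, ordered compatibly with the Euler form, is
a `Q`-admissible ordering. -/
theorem isQAdmissible_of_eulerForm {k : Type u} [Field k] {V : Type} [Fintype V] [Quiver.{0} V]
    [hfin : ∀ i j : V, Finite (i ⟶ j)] (hq : ∀ x : V → ℤ, x ≠ 0 → 0 < eulerForm V x x)
    {L : List (V → ℤ)} (hnodup : L.Nodup) (hpos : ∀ β, β ∈ L ↔ β ∈ posRoots V)
    (hroot : ∀ β : V → ℤ, (∀ i, 0 ≤ β i) → eulerForm V β β = 1 → β ∈ L)
    (hL : ∀ r t : Fin L.length, 0 < eulerForm V L[r] L[t] → r ≤ t) :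
    IsQAdmissible k V L := by
  refine ⟨hnodup, hpos, fun r t M N hM hN => ?_⟩
  have hfM : Rep.IsFin M := ⟨hM.finite⟩
  have hfN : Rep.IsFin N := ⟨hN.finite⟩
  have hdM : Rep.dimVec M = L[r] := funext hM.dim
  have hdN : Rep.dimVec N = L[t] := funext hN.dim
  have hidx : ∀ X : Rep k V, Rep.IsFin X → Indecomposable X →
      ∃ s : Fin L.length, Rep.dimVec X = L[s] := fun X _ hX => by
    obtain ⟨s, hs, h⟩ := List.mem_iff_getElem.1 (hroot _ (Rep.dimVec_nonneg X)
      (Rep.extVanishes_self_and_eulerForm_eq_one hq X hX).2)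
    exact ⟨⟨s, hs⟩, h.symm⟩
  have hHom : ∀ (X Y : Rep k V) (a b : Fin L.length), Rep.IsFin X → Rep.IsFin Y →
      Indecomposable X → Indecomposable Y → Rep.dimVec X = L[a] → Rep.dimVec Y = L[b] →
      (∃ f : X ⟶ Y, f ≠ 0) → a ≤ b := by
    rintro X Y a b _ _ hX hY ha hb ⟨f, hf⟩
    obtain ⟨Z, p, j, hfZ, hZ, -, -, h1, h2⟩ := Rep.exists_between hq hX hY f hf
    obtain ⟨c, hc⟩ := hidx Z hfZ hZ
    rw [ha, hc] at h1
    rw [hb, hc] at h2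
    exact (hL _ _ h1).trans (hL _ _ h2)
  constructor
  · intro h
    exact hHom M N r t hfM hfN hM.indecomposable hN.indecomposable hdM hdN (exists_ne 0)
  · intro h
    obtain ⟨X, f, g, hfX, hX, hf, hg⟩ := Rep.exists_between_of_ext h
    obtain ⟨c, hc⟩ := hidx X hfX hX
    have htc := hHom N X t c hfN hfX hN.indecomposable hX hdN hc ⟨f, hf⟩
    have hcr := hHom X M c r hfX hfM hX hM.indecomposable hc hdM ⟨g, hg⟩
    -- If r = t, then M and N have equal dimension vectors of norm one, so a nonzero map M ⟶ N
    -- exists. It can be replaced by one through an X of that same dimension vector, which is epi,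
    -- and Ext¹(M, N) becomes a quotient of Ext¹(M, M) = 0.
    refine lt_of_le_of_ne (htc.trans hcr) ?_
    rintro rfl
    have hdim : Rep.dimVec M = Rep.dimVec N := hdM.trans hdN.symm
    obtain ⟨φ, hφ⟩ : ∃ φ : M ⟶ N, φ ≠ 0 := by
      have h1 := Rep.eulerForm_le_finrank_hom M N
      rw [← hdim, (Rep.extVanishes_self_and_eulerForm_eq_one hq M hM.indecomposable).2] at h1
      have := Module.finrank_pos_iff.1 (show 0 < Module.finrank k (M ⟶ N) by lia)
      exact exists_ne 0
    obtain ⟨Y, p, j, hfY, hY, hp, hj, h1, h2⟩ :=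
      Rep.exists_between hq hM.indecomposable hN.indecomposable φ hφ
    obtain ⟨s, hs⟩ := hidx Y hfY hY
    rw [hs, hdM] at h1
    rw [hs, hdN] at h2
    obtain rfl := le_antisymm (hL _ _ h1) (hL _ _ h2)
    have hj' : Epi j := Rep.epi_of_mono_of_dimVec j fun i => by rw [hs, hdN]
    have hpj : Epi (p ≫ j) := epi_comp _ _
    exact Rep.not_extVanishes_of_ext h
      ((Rep.extVanishes_self_and_eulerForm_eq_one hq M hM.indecomposable).1.of_epi (p ≫ j))


/-! ### The Cartan form and the simple reflections. -/

section CartanForm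

lemma simpleRoot_self {V : Type} (i : V) : simpleRoot i i = 1 := by simp [simpleRoot]

lemma simpleRoot_of_ne {V : Type} {i j : V} (h : j ≠ i) : simpleRoot i j = 0 := by
  simp [simpleRoot, h]

lemma simpleRoot_nonneg {V : Type} (i : V) : 0 ≤ simpleRoot i := fun j => by
  by_cases h : j = i
  · rw [h, simpleRoot_self]
    exact zero_le_one
  · rw [simpleRoot_of_ne h]
    rfl

lemma simpleRoot_injective {V : Type} : Function.Injective (simpleRoot (V := V)) := by
  intro i j h
  by_contra hne
  have := congrFun h i
  rw [simpleRoot_self, simpleRoot_of_ne hne] at this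
  exact one_ne_zero this

lemma eq_sum_simpleRoot {V : Type} [Fintype V] (x : V → ℤ) : x = ∑ i, x i • simpleRoot i := by
  classical
  funext j
  simp [simpleRoot, Finset.sum_apply, Pi.single_apply]

variable {V : Type} [Quiver.{0} V]

lemma cartan_self (i : V) : cartan V i i = 2 := if_pos rfl

lemma cartan_comm (i j : V) : cartan V i j = cartan V j i := by
  unfold cartan
  by_cases h : i = j
  · rw [if_pos h, if_pos h.symm]
  · rw [if_neg h, if_neg (Ne.symm h), add_comm]

lemma cartan_nonpos {i j : V} (h : i ≠ j) : cartan V i j ≤ 0 := by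
  unfold cartan
  rw [if_neg h]
  lia

variable [Fintype V]

open scoped Classical in
variable (V) in
/-- The symmetric bilinear form given by the Cartan matrix. -/
def form : LinearMap.BilinForm ℤ (V → ℤ) := Matrix.toBilin' (cartan V)

lemma form_apply (x y : V → ℤ) : form V x y = ∑ i, ∑ j, x i * cartan V i j * y j := by
  classical
  rw [form, Matrix.toBilin'_apply]

lemma form_comm (x y : V → ℤ) : form V x y = form V y x := by
  rw [form_apply, form_apply, Finset.sum_comm]
  refine Finset.sum_congr rfl fun i _ => Finset.sum_congr rfl fun j _ => ?_
  rw [cartan_comm j i]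
  ring

lemma form_simpleRoot (i : V) (x : V → ℤ) : form V (simpleRoot i) x = corootForm V i x := by
  classical
  rw [form_apply, Finset.sum_eq_single i]
  · simp [simpleRoot_self, corootForm, Matrix.mulVec, dotProduct]
  · intro j _ hj
    simp [simpleRoot_of_ne hj]
  · simp

lemma form_simpleRoot_simpleRoot (i j : V) :
    form V (simpleRoot i) (simpleRoot j) = cartan V i j := by
  classical
  rw [form_apply, Finset.sum_eq_single i, Finset.sum_eq_single j]
  · simp [simpleRoot_self]
  · intro a _ ha
    simp [simpleRoot_of_ne ha]
  · simp
  · intro a _ ha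
    simp [simpleRoot_of_ne ha]
  · simp

lemma form_eq_sum (x y : V → ℤ) : form V x y = ∑ i, x i * form V (simpleRoot i) y := by
  conv_lhs => rw [eq_sum_simpleRoot x]
  simp only [map_sum, LinearMap.sum_apply, map_smul, LinearMap.smul_apply, smul_eq_mul]

lemma simpleRefl_apply (i : V) (x : V → ℤ) :
    simpleRefl V i x = x - form V (simpleRoot i) x • simpleRoot i := by
  rw [form_simpleRoot, simpleRefl, Module.reflection_apply]

lemma simpleRefl_simpleRefl (i : V) (x : V → ℤ) : simpleRefl V i (simpleRefl V i x) = x :=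
  Module.involutive_reflection _ x

lemma simpleRefl_mul_self (i : V) : simpleRefl V i * simpleRefl V i = 1 :=
  LinearEquiv.ext (simpleRefl_simpleRefl i)

lemma simpleRefl_simpleRoot (i : V) : simpleRefl V i (simpleRoot i) = -simpleRoot i :=
  Module.reflection_apply_self _

lemma simpleRefl_apply_of_ne {i j : V} (h : j ≠ i) (x : V → ℤ) : simpleRefl V i x j = x j := by
  rw [simpleRefl_apply, Pi.sub_apply, Pi.smul_apply, simpleRoot_of_ne h, smul_zero, sub_zero]

lemma form_simpleRefl (i : V) (x y : V → ℤ) :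
    form V (simpleRefl V i x) (simpleRefl V i y) = form V x y := by
  simp only [simpleRefl_apply, map_sub, map_smul, LinearMap.sub_apply, LinearMap.smul_apply,
    smul_eq_mul, form_simpleRoot_simpleRoot, cartan_self, form_comm x (simpleRoot i)]
  ring

lemma form_of_mem_weylGroup {w : (V → ℤ) ≃ₗ[ℤ] (V → ℤ)} (hw : w ∈ weylGroup V) (x y : V → ℤ) :
    form V (w x) (w y) = form V x y := by
  induction hw using Subgroup.closure_induction generalizing x y with
  | mem w h =>
    obtain ⟨i, rfl⟩ := h
    exact form_simpleRefl i x y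
  | one => rfl
  | mul a b _ _ ha hb => exact (ha _ _).trans (hb x y)
  | inv a _ ha =>
    rw [← ha (a⁻¹ x) (a⁻¹ y), ← LinearEquiv.mul_apply, ← LinearEquiv.mul_apply,
      mul_inv_cancel]
    rfl

end CartanForm

/-! ### Orientations, their Euler forms, and reflection at a sink. -/

section Roots

variable {V : Type} [Fintype V] [Quiver.{0} V]

lemma form_pos (hQ : IsDynkin V) {x : V → ℤ} (hx : x ≠ 0) : 0 < form V x x := by
  have h0 : (fun i => (x i : ℝ)) ≠ 0 := fun h => hx (funext fun i => by
    have h1 : (x i : ℝ) = 0 := congrFun h i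
    exact_mod_cast h1)
  have h := hQ.posDef.dotProduct_mulVec_pos h0
  have h1 : ((form V x x : ℤ) : ℝ) =
      dotProduct (star fun i => (x i : ℝ)) (((cartan V).map (Int.cast : ℤ → ℝ)).mulVec
        fun i => (x i : ℝ)) := by
    rw [form_apply]
    push_cast
    simp only [dotProduct, Matrix.mulVec, Finset.mul_sum, star_trivial, Matrix.map_apply, mul_assoc]
  rw [← h1] at h
  exact_mod_cast h

/-- A matrix of nonnegative integers whose entries count the arrows of an orientation of the
underlying graph of the quiver. -/
structure IsOrientation (n : Matrix V V ℤ) : Prop where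
  nonneg : ∀ i j, 0 ≤ n i j
  diag : ∀ i, n i i = 0
  offdiag : ∀ i j, i ≠ j → n i j + n j i = -cartan V i j

open scoped Classical in
/-- The Euler form attached to a matrix counting arrows. -/
def euler {V : Type} [Fintype V] (n : Matrix V V ℤ) : LinearMap.BilinForm ℤ (V → ℤ) :=
  Matrix.toBilin' (1 - n)

lemma euler_apply {V : Type} [Fintype V] (n : Matrix V V ℤ) (x y : V → ℤ) :
    euler n x y = ∑ i, x i * y i - ∑ i, ∑ j, n i j * (x i * y j) := by
  classical
  rw [euler, Matrix.toBilin'_apply, ← Finset.sum_sub_distrib]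
  refine Finset.sum_congr rfl fun i _ => ?_
  simp only [Matrix.sub_apply, Matrix.one_apply, mul_sub, sub_mul, Finset.sum_sub_distrib]
  congr 1
  · simp
  · exact Finset.sum_congr rfl fun j _ => by ring

/-- The matrix counting the arrows of a quiver. -/
def arrowMatrix {V : Type} (Q : Quiver.{0} V) : Matrix V V ℤ := fun i j => Nat.card (Q.Hom i j)

lemma eulerForm_eq {V : Type} [Fintype V] [Q : Quiver.{0} V] (x y : V → ℤ) :
    eulerForm V x y = euler (arrowMatrix Q) x y := by
  rw [euler_apply]
  rfl

lemma IsDynkin.isOrientation {V : Type} [Fintype V] [Q : Quiver.{0} V] (hQ : IsDynkin V) :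
    IsOrientation (arrowMatrix Q) where
  nonneg _ _ := Int.natCast_nonneg _
  diag i := by
    have : IsEmpty (i ⟶ i) := ⟨fun a => by
      have := hQ.acyclic i a.toPath
      simp at this⟩
    exact Int.natCast_eq_zero.2 Nat.card_of_isEmpty
  offdiag i j h := by
    rw [cartan, if_neg h, neg_neg]
    rfl

lemma euler_simpleRoot_of_sink {V : Type} [Fintype V] {n : Matrix V V ℤ} {l : V} (hl : ∀ j, n l j = 0) (y : V → ℤ) :
    euler n (simpleRoot l) y = y l := by
  classical
  rw [euler_apply, Finset.sum_eq_single l, Finset.sum_eq_single l]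
  · simp [simpleRoot_self, hl]
  · intro i _ hi
    simp [simpleRoot_of_ne hi]
  · simp
  · intro i _ hi
    simp [simpleRoot_of_ne hi]
  · simp

lemma euler_simpleRoot_simpleRoot {V : Type} [Fintype V] (n : Matrix V V ℤ) (i j : V) (hij : i ≠ j) :
    euler n (simpleRoot i) (simpleRoot j) = -n i j := by
  classical
  have h : ∀ i : V, simpleRoot i = Pi.single i (1 : ℤ) := fun i => by
    unfold simpleRoot
    congr
  rw [h, h, euler, Matrix.toBilin'_single, Matrix.sub_apply, Matrix.one_apply_ne hij, zero_sub]

open scoped Classical in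
/-- The matrix counting arrows after all arrows at `l` have been reversed. -/
def reflectMatrix {V : Type} (n : Matrix V V ℤ) (l : V) : Matrix V V ℤ :=
  fun a b => if a = l ∨ b = l then n b a else n a b

namespace IsOrientation

variable {n : Matrix V V ℤ} (hn : IsOrientation n)

include hn

lemma form_eq (x y : V → ℤ) : form V x y = euler n x y + euler n y x := by
  classical
  have h : ∀ i j, cartan V i j = (1 - n) i j + (1 - n) j i := fun i j => by
    by_cases hij : i = j
    · subst hij
      simp [cartan_self, hn.diag]
    · have := hn.offdiag i j hij
      simp only [Matrix.sub_apply, Matrix.one_apply_ne hij, Matrix.one_apply_ne (Ne.symm hij)]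
      lia
  rw [form_apply, euler, Matrix.toBilin'_apply, Matrix.toBilin'_apply,
    Finset.sum_comm (f := fun i j => y i * (1 - n) i j * x j), ← Finset.sum_add_distrib]
  refine Finset.sum_congr rfl fun i _ => ?_
  rw [← Finset.sum_add_distrib]
  refine Finset.sum_congr rfl fun j _ => ?_
  rw [h]
  ring

lemma form_self (x : V → ℤ) : form V x x = 2 * euler n x x := by
  rw [hn.form_eq]
  ring

lemma euler_simpleRoot_right_of_sink {l : V} (hl : ∀ j, n l j = 0) (x : V → ℤ) :
    euler n x (simpleRoot l) = form V (simpleRoot l) x - x l := by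
  rw [hn.form_eq, euler_simpleRoot_of_sink hl]
  ring

omit [Fintype V] in
lemma reflect (l : V) : IsOrientation (reflectMatrix n l) where
  nonneg i j := by
    unfold reflectMatrix
    split_ifs
    exacts [hn.nonneg _ _, hn.nonneg _ _]
  diag i := by
    unfold reflectMatrix
    split_ifs
    exacts [hn.diag _, hn.diag _]
  offdiag i j h := by
    have := hn.offdiag i j h
    unfold reflectMatrix
    by_cases hij : i = l ∨ j = l
    · rw [if_pos hij, if_pos hij.symm]
      lia
    · rw [if_neg hij, if_neg fun h => hij h.symm]
      lia

/-- The numerical shadow of the Bernstein–Gelfand–Ponomarev reflection functor: s_l is an isometry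
between the Euler forms before and after reversing a sink. -/
lemma euler_reflectMatrix {l : V} (hl : ∀ j, n l j = 0) (x y : V → ℤ) :
    euler (reflectMatrix n l) x y = euler n (simpleRefl V l x) (simpleRefl V l y) := by
  classical
  -- Row l of n is zero at a sink, so the reversal just moves column l to row l.
  have h1 : ∀ i j, reflectMatrix n l i j =
      n i j - (if j = l then n i l else 0) + (if i = l then n j l else 0) := by
    intro i j
    unfold reflectMatrix
    by_cases hi : i = l <;> by_cases hj : j = l
    · subst hi; subst hj; simp
    · subst hi; simp [hj, hl]
    · subst hj; simp [hi, hl]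
    · simp [hi, hj]
  have h2 : euler (reflectMatrix n l) x y =
      euler n x y + (∑ i, n i l * x i) * y l - x l * ∑ j, n j l * y j := by
    rw [euler_apply, euler_apply]
    simp only [h1, add_mul, sub_mul, Finset.sum_add_distrib, Finset.sum_sub_distrib, ite_mul,
      zero_mul, Finset.sum_ite_eq', Finset.mem_univ, if_true]
    have h3 : ∑ i, ∑ j, (if i = l then n j l * (x i * y j) else 0) = x l * ∑ j, n j l * y j := by
      rw [Finset.sum_comm, Finset.mul_sum]
      refine Finset.sum_congr rfl fun j _ => ?_
      rw [Finset.sum_ite_eq' Finset.univ l, if_pos (Finset.mem_univ l)]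
      ring
    have h4 : ∑ i, n i l * (x i * y l) = (∑ i, n i l * x i) * y l := by
      rw [Finset.sum_mul]
      exact Finset.sum_congr rfl fun i _ => by ring
    rw [h3, h4]
    ring
  have h5 : ∀ z : V → ℤ, ∑ i, n i l * z i = 2 * z l - form V (simpleRoot l) z := by
    intro z
    have h := hn.euler_simpleRoot_right_of_sink hl z
    rw [euler_apply, Finset.sum_eq_single l] at h
    · have h6 : ∀ i, ∑ j, n i j * (z i * simpleRoot l j) = n i l * z i := fun i => by
        rw [Finset.sum_eq_single l]
        · rw [simpleRoot_self, mul_one]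
        · intro j _ hj
          simp [simpleRoot_of_ne hj]
        · simp
      simp only [h6, simpleRoot_self] at h
      lia
    · intro i _ hi
      simp [simpleRoot_of_ne hi]
    · simp
  have h6 : euler n (simpleRoot l) (simpleRoot l) = 1 := by
    rw [euler_simpleRoot_of_sink hl, simpleRoot_self]
  rw [h2, h5, h5]
  simp only [simpleRefl_apply, map_sub, map_smul, LinearMap.sub_apply, LinearMap.smul_apply,
    smul_eq_mul, h6, euler_simpleRoot_of_sink hl, hn.euler_simpleRoot_right_of_sink hl]
  ring

end IsOrientation

/-! ### Roots -/

variable (hQ : IsDynkin V)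

include hQ

lemma eulerForm_pos {x : V → ℤ} (hx : x ≠ 0) : 0 < eulerForm V x x := by
  have h := form_pos hQ hx
  rw [hQ.isOrientation.form_self] at h
  rw [eulerForm_eq]
  lia

/-- The positive and negative parts p, q have disjoint supports, so (p, q) ≤ 0 and (x, x) ≥ (p, p) +
(q, q). The form is even and positive definite, so this sum is at least 4 when both parts are
nonzero. -/
lemma nonneg_or_nonpos {x : V → ℤ} (hx : form V x x = 2) : 0 ≤ x ∨ x ≤ 0 := by
  set p : V → ℤ := x ⊔ 0 with hp
  set q : V → ℤ := (-x) ⊔ 0 with hq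
  have hxpq : x = p - q := by
    funext i
    simp only [hp, hq, Pi.sub_apply, Pi.sup_apply, Pi.neg_apply, Pi.zero_apply]
    lia
  have hpq : form V p q ≤ 0 := by
    rw [form_apply]
    refine Finset.sum_nonpos fun i _ => Finset.sum_nonpos fun j _ => ?_
    by_cases hij : i = j
    · subst hij
      have : p i * q i = 0 := by
        simp only [hp, hq, Pi.sup_apply, Pi.neg_apply, Pi.zero_apply]
        rcases le_total (x i) 0 with h | h
        · rw [sup_of_le_right h, zero_mul]
        · rw [sup_of_le_right (neg_nonpos.2 h), mul_zero]
      rw [mul_right_comm, this, zero_mul]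
    · have h1 : 0 ≤ p i := le_sup_right
      have h2 : 0 ≤ q j := le_sup_right
      exact mul_nonpos_of_nonpos_of_nonneg
        (mul_nonpos_of_nonneg_of_nonpos h1 (cartan_nonpos hij)) h2
  have hexp : form V x x = form V p p + form V q q - 2 * form V p q := by
    rw [hxpq]
    simp only [map_sub, LinearMap.sub_apply, form_comm q p]
    ring
  have hp2 := hQ.isOrientation.form_self p
  have hq2 := hQ.isOrientation.form_self q
  by_cases hp0 : p = 0
  · right
    exact le_of_le_of_eq le_sup_left hp0
  by_cases hq0 : q = 0
  · left
    exact neg_nonpos.1 (le_of_le_of_eq le_sup_left hq0)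
  have := form_pos hQ hp0
  have := form_pos hQ hq0
  lia

end Roots


/-! ### Weyl group: exchange property, positive roots, finiteness. -/

section Weyl

variable {V : Type} [Fintype V] [Quiver.{0} V]

lemma simpleRefl_mem (i : V) : simpleRefl V i ∈ weylGroup V := Subgroup.subset_closure ⟨i, rfl⟩

lemma form_simpleRoot_self (i : V) : form V (simpleRoot i) (simpleRoot i) = 2 := by
  rw [form_simpleRoot_simpleRoot, cartan_self]

/-- Each element of the Weyl group is a product of simple reflections. -/
lemma exists_word {w : (V → ℤ) ≃ₗ[ℤ] (V → ℤ)} (hw : w ∈ weylGroup V) :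
    ∃ l : List V, (l.map (simpleRefl V)).prod = w := by
  induction hw using Subgroup.closure_induction with
  | mem w h =>
    obtain ⟨i, rfl⟩ := h
    exact ⟨[i], by simp⟩
  | one => exact ⟨[], rfl⟩
  | mul a b _ _ ha hb =>
    obtain ⟨la, rfl⟩ := ha
    obtain ⟨lb, rfl⟩ := hb
    exact ⟨la ++ lb, by simp⟩
  | inv a _ ha =>
    obtain ⟨la, rfl⟩ := ha
    refine ⟨la.reverse, ?_⟩
    rw [List.prod_inv_reverse, List.map_map, ← List.map_reverse]
    congr 1

lemma prod_mem_weylGroup (l : List V) : (l.map (simpleRefl V)).prod ∈ weylGroup V :=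
  Subgroup.list_prod_mem _ fun x hx => by
    obtain ⟨i, -, rfl⟩ := List.mem_map.1 hx
    exact simpleRefl_mem i

variable (hQ : IsDynkin V)

include hQ

omit hQ in
lemma not_nonneg_neg {x : V → ℤ} (hx : form V x x = 2) (h : 0 ≤ x) : ¬ 0 ≤ -x := fun h' => by
  have : x = 0 := le_antisymm (neg_nonneg.1 h') h
  subst this
  simp at hx

lemma not_nonneg_iff {x : V → ℤ} (hx : form V x x = 2) : ¬ 0 ≤ x ↔ 0 ≤ -x := by
  refine ⟨fun h => neg_nonneg.2 ((nonneg_or_nonpos hQ hx).resolve_left h), fun h h' =>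
    not_nonneg_neg hx h' h⟩

/-- A simple reflection permutes the positive roots other than the simple root. -/
lemma simpleRefl_nonneg {x : V → ℤ} (hx : form V x x = 2) (h : 0 ≤ x) {i : V}
    (hi : x ≠ simpleRoot i) : 0 ≤ simpleRefl V i x := by
  by_contra hneg
  rw [not_nonneg_iff hQ (by rwa [form_simpleRefl])] at hneg
  -- A reflection s_i alters the i-th coordinate only, so a root that changes sign is supported at
  -- i.
  have hz : ∀ j, j ≠ i → x j = 0 := fun j hj => by
    have h1 := hneg j
    rw [Pi.neg_apply, simpleRefl_apply_of_ne hj] at h1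
    have h2 := h j
    simp only [Pi.zero_apply] at h1 h2
    lia
  have hxi : x = x i • simpleRoot i := by
    funext j
    by_cases hj : j = i
    · subst hj
      simp [simpleRoot_self]
    · simp [simpleRoot_of_ne hj, hz j hj]
  have h1 : x i * x i = 1 := by
    rw [hxi] at hx
    simp only [map_smul, LinearMap.smul_apply, smul_eq_mul, form_simpleRoot_self] at hx
    linarith
  have h2 : x i = 1 := by
    have := h i
    simp only [Pi.zero_apply] at this
    nlinarith
  rw [h2, one_smul] at hxi
  exact hi hxi

/-- The exchange property of the Weyl group. -/
lemma exists_exchange (i : V) : ∀ l : List V,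
    ¬ 0 ≤ (l.map (simpleRefl V)).prod (simpleRoot i) →
      ∃ l' : List V, l'.length + 1 = l.length ∧
        (l.map (simpleRefl V)).prod = (l'.map (simpleRefl V)).prod * simpleRefl V i := by
  intro l
  induction l with
  | nil =>
    intro h
    exact absurd (simpleRoot_nonneg i) h
  | cons a l ih =>
    intro h
    rw [List.map_cons, List.prod_cons] at h ⊢
    set p := (l.map (simpleRefl V)).prod with hp
    have hpW : p ∈ weylGroup V := prod_mem_weylGroup l
    by_cases h0 : 0 ≤ p (simpleRoot i)
    · have hroot : form V (p (simpleRoot i)) (p (simpleRoot i)) = 2 := by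
        rw [form_of_mem_weylGroup hpW, form_simpleRoot_self]
      -- The letter a is where the image of α_i turns negative, which forces p α_i = α_a and hence
      -- s_a p = p s_i.
      have ha : p (simpleRoot i) = simpleRoot a := by
        by_contra hne
        exact h (simpleRefl_nonneg hQ hroot h0 hne)
      refine ⟨l, rfl, ?_⟩
      rw [← hp]
      refine LinearEquiv.ext fun x => ?_
      rw [LinearEquiv.mul_apply, LinearEquiv.mul_apply, simpleRefl_apply, simpleRefl_apply,
        map_sub, map_smul, ha, ← form_of_mem_weylGroup hpW (simpleRoot i), ha]
    · obtain ⟨l', hl, h'⟩ := ih h0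
      refine ⟨a :: l', by simpa using hl, ?_⟩
      rw [h', List.map_cons, List.prod_cons, mul_assoc]

/-- An element of the Weyl group which maps all simple roots to positive roots is trivial. -/
lemma eq_one_of_nonneg {w : (V → ℤ) ≃ₗ[ℤ] (V → ℤ)} (hw : w ∈ weylGroup V)
    (h : ∀ i, 0 ≤ w (simpleRoot i)) : w = 1 := by
  classical
  let P : ℕ → Prop := fun m => ∃ l : List V, (l.map (simpleRefl V)).prod = w ∧ l.length = m
  have hP : ∃ m, P m := by
    obtain ⟨l, hl⟩ := exists_word hw
    exact ⟨_, l, hl, rfl⟩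
  obtain ⟨l, hl, hlen⟩ := Nat.find_spec hP
  have hmin : ∀ m, P m → l.length ≤ m := fun m hm => hlen ▸ Nat.find_min' hP hm
  obtain rfl | ⟨l₁, i, rfl⟩ := List.eq_nil_or_concat' l
  · exact hl.symm
  · rw [List.map_append, List.prod_append, List.map_singleton, List.prod_singleton] at hl
    -- Since w α_i is positive, the word without its last letter s_i sends α_i to a negative root.
    -- Exchange then rewrites w with two letters fewer, against minimality.
    have hneg : ¬ 0 ≤ (l₁.map (simpleRefl V)).prod (simpleRoot i) := by
      have h1 := h i
      rw [← hl, LinearEquiv.mul_apply, simpleRefl_simpleRoot, map_neg] at h1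
      refine fun h2 => not_nonneg_neg ?_ h2 h1
      rw [form_of_mem_weylGroup (prod_mem_weylGroup l₁), form_simpleRoot_self]
    obtain ⟨l', hlen', h'⟩ := exists_exchange hQ i l₁ hneg
    have := hmin l'.length ⟨l', by
      rw [← hl, h', mul_assoc, simpleRefl_mul_self, mul_one], rfl⟩
    simp only [List.length_append, List.length_singleton] at this
    lia

omit hQ in
lemma form_eq_two_of_mem_roots {x : V → ℤ} (hx : x ∈ roots V) : form V x x = 2 := by
  obtain ⟨w, hw, i, rfl⟩ := hx
  rw [form_of_mem_weylGroup hw, form_simpleRoot_self]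

/-- The positive roots are the nonnegative vectors of norm two. -/
lemma mem_posRoots_iff (x : V → ℤ) : x ∈ posRoots V ↔ form V x x = 2 ∧ 0 ≤ x := by
  refine ⟨fun h => ⟨form_eq_two_of_mem_roots h.1, h.2⟩, fun h => ⟨?_, h.2⟩⟩
  obtain ⟨hx, h⟩ := h
  induction hm : (∑ i, x i).toNat using Nat.strong_induction_on generalizing x with
  | _ m ih =>
  by_cases hs : ∃ i, x = simpleRoot i
  · obtain ⟨i, rfl⟩ := hs
    exact ⟨1, one_mem _, i, rfl⟩
  · push Not at hs
    -- These products sum to (x, x) = 2. Reflecting at such an i strictly lowers the height and, x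
    -- not being simple, keeps it positive.
    obtain ⟨i, hi⟩ : ∃ i, 0 < x i * form V (simpleRoot i) x := by
      by_contra! hcon
      have := Finset.sum_nonpos fun i (_ : i ∈ Finset.univ) => hcon i
      rw [← form_eq_sum, hx] at this
      lia
    have hfi : 0 < form V (simpleRoot i) x := by
      have := h i
      simp only [Pi.zero_apply] at this
      exact pos_of_mul_pos_right hi this
    have hpos := simpleRefl_nonneg hQ hx h (hs i)
    have hsum : ∑ j, simpleRefl V i x j < ∑ j, x j := by
      refine Finset.sum_lt_sum (fun j _ => ?_) ⟨i, Finset.mem_univ i, ?_⟩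
      · by_cases hj : j = i
        · subst hj
          rw [simpleRefl_apply]
          simp only [Pi.sub_apply, Pi.smul_apply, simpleRoot_self, smul_eq_mul]
          lia
        · rw [simpleRefl_apply_of_ne hj]
      · rw [simpleRefl_apply]
        simp only [Pi.sub_apply, Pi.smul_apply, simpleRoot_self, smul_eq_mul]
        lia
    have h0 : 0 ≤ ∑ j, simpleRefl V i x j := Finset.sum_nonneg fun j _ => hpos j
    obtain ⟨w, hw, j, hwj⟩ := ih _ (by lia) (simpleRefl V i x) (by rwa [form_simpleRefl]) hpos rfl
    refine ⟨simpleRefl V i * w, mul_mem (simpleRefl_mem i) hw, j, ?_⟩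
    rw [LinearEquiv.mul_apply, hwj, simpleRefl_simpleRefl]

/-- A vector is determined by its pairings with the simple roots, and for norm two these lie in [−2,
2] because x ± α_i have nonnegative norm. -/
lemma finite_roots : {x : V → ℤ | form V x x = 2}.Finite := by
  have hinj : Function.Injective fun (x : V → ℤ) (i : V) => form V (simpleRoot i) x := by
    intro x y hxy
    by_contra hne
    have h := form_pos hQ (sub_ne_zero.2 hne)
    rw [form_eq_sum] at h
    refine h.ne' (Finset.sum_eq_zero fun i _ => ?_)
    rw [map_sub, sub_eq_zero.2 (congrFun hxy i), mul_zero]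
  refine Set.Finite.of_finite_image (Set.Finite.subset
    (Set.Finite.pi' fun _ : V => Set.finite_Icc (-2 : ℤ) 2) ?_) hinj.injOn
  rintro _ ⟨x, hx, rfl⟩ i
  have hnn : ∀ y : V → ℤ, 0 ≤ form V y y := fun y => by
    by_cases hy : y = 0
    · rw [hy]; simp
    · exact (form_pos hQ hy).le
  have hx' : form V x x = 2 := hx
  have h1 := hnn (x + simpleRoot i)
  have h2 := hnn (x - simpleRoot i)
  simp only [map_add, map_sub, LinearMap.add_apply, LinearMap.sub_apply, form_simpleRoot_self,
    form_comm x (simpleRoot i), hx'] at h1 h2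
  rw [Set.mem_Icc]
  constructor <;> lia

end Weyl


/-- An involution of the underlying diagram of a quiver such that no vertex is joined to a
different vertex of its orbit. -/
structure IsDiagramInvolution {V : Type} [Quiver.{0} V] (τ : Equiv.Perm V) : Prop where
  apply_apply : ∀ i, τ (τ i) = i
  cartan : ∀ i j, cartan V (τ i) (τ j) = cartan V i j
  orth : ∀ i, τ i ≠ i → IQuiver.cartan V i (τ i) = 0

/-! ### The action of τ, the reflections 𝐬_i, and τ-orbits of inversions. -/

section Lattice

variable {V : Type}

lemma latticePerm_apply (τ : Equiv.Perm V) (x : V → ℤ) (i : V) :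
    latticePerm τ x i = x (τ.symm i) := rfl

lemma latticePerm_simpleRoot (τ : Equiv.Perm V) (i : V) :
    latticePerm τ (simpleRoot i) = simpleRoot (τ i) := by
  funext j
  rw [latticePerm_apply]
  by_cases h : j = τ i
  · subst h
    rw [Equiv.symm_apply_apply, simpleRoot_self, simpleRoot_self]
  · rw [simpleRoot_of_ne h, simpleRoot_of_ne]
    rintro rfl
    exact h (τ.apply_symm_apply j).symm

lemma latticePerm_nonneg {τ : Equiv.Perm V} {x : V → ℤ} (h : 0 ≤ x) : 0 ≤ latticePerm τ x :=
  fun _ => h _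

end Lattice

section

variable {V : Type} [Fintype V] [Quiver.{0} V] {τ : Equiv.Perm V} (hτ : IsDiagramInvolution τ)

lemma mem_restrictedWeylGroup_iff {w : (V → ℤ) ≃ₗ[ℤ] (V → ℤ)} :
    w ∈ restrictedWeylGroup V τ ↔
      w ∈ weylGroup V ∧ ∀ x, latticePerm τ (w x) = w (latticePerm τ x) := by
  rw [restrictedWeylGroup, Subgroup.mem_inf, Subgroup.mem_centralizer_singleton_iff]
  refine and_congr_right fun _ => ?_
  rw [LinearEquiv.ext_iff]
  simp only [LinearEquiv.mul_apply]
  exact ⟨fun h x => (h x).symm, fun h x => (h x).symm⟩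

include hτ

omit [Fintype V] in
lemma latticePerm_latticePerm (x : V → ℤ) : latticePerm τ (latticePerm τ x) = x := by
  funext i
  rw [latticePerm_apply, latticePerm_apply]
  congr 1
  rw [Equiv.symm_apply_eq, Equiv.symm_apply_eq, hτ.apply_apply]

lemma form_latticePerm (x y : V → ℤ) :
    form V (latticePerm τ x) (latticePerm τ y) = form V x y := by
  rw [form_apply, form_apply, ← Equiv.sum_comp τ]
  refine Finset.sum_congr rfl fun i _ => ?_
  rw [← Equiv.sum_comp τ]
  refine Finset.sum_congr rfl fun j _ => ?_
  rw [latticePerm_apply, latticePerm_apply, Equiv.symm_apply_apply, Equiv.symm_apply_apply,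
    hτ.cartan]

lemma latticePerm_simpleRefl (i : V) (x : V → ℤ) :
    latticePerm τ (simpleRefl V i x) = simpleRefl V (τ i) (latticePerm τ x) := by
  rw [simpleRefl_apply, simpleRefl_apply, map_sub, map_smul, latticePerm_simpleRoot,
    ← latticePerm_simpleRoot, form_latticePerm hτ]

lemma form_orth {i : V} (h : τ i ≠ i) : form V (simpleRoot i) (simpleRoot (τ i)) = 0 := by
  rw [form_simpleRoot_simpleRoot, hτ.orth i h]

lemma simpleRefl_orth {i : V} (h : τ i ≠ i) :
    simpleRefl V i (simpleRoot (τ i)) = simpleRoot (τ i) := by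
  rw [simpleRefl_apply, form_orth hτ h, zero_smul, sub_zero]

lemma simpleRefl_orth' {i : V} (h : τ i ≠ i) :
    simpleRefl V (τ i) (simpleRoot i) = simpleRoot i := by
  rw [simpleRefl_apply, form_comm, form_orth hτ h, zero_smul, sub_zero]

lemma simpleRefl_commute {i : V} (h : τ i ≠ i) (x : V → ℤ) :
    simpleRefl V i (simpleRefl V (τ i) x) = simpleRefl V (τ i) (simpleRefl V i x) := by
  rw [simpleRefl_apply (τ i), map_sub, map_smul, simpleRefl_orth hτ h, simpleRefl_apply (τ i)]
  rw [simpleRefl_apply i, map_sub, map_smul, form_comm _ (simpleRoot i), form_orth hτ h,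
    smul_zero, sub_zero]

omit hτ in
lemma iRefl_apply_of_eq {i : V} (h : τ i = i) (x : V → ℤ) :
    iRefl V τ i x = simpleRefl V i x := by
  rw [iRefl, if_pos h]

omit hτ in
lemma iRefl_apply_of_ne {i : V} (h : τ i ≠ i) (x : V → ℤ) :
    iRefl V τ i x = simpleRefl V i (simpleRefl V (τ i) x) := by
  rw [iRefl, if_neg h, LinearEquiv.mul_apply]

lemma iRefl_iRefl (i : V) (x : V → ℤ) : iRefl V τ i (iRefl V τ i x) = x := by
  by_cases h : τ i = i
  · rw [iRefl_apply_of_eq h, iRefl_apply_of_eq h, simpleRefl_simpleRefl]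
  · rw [iRefl_apply_of_ne h, iRefl_apply_of_ne h, simpleRefl_commute hτ h,
      simpleRefl_simpleRefl, simpleRefl_simpleRefl]

lemma iRefl_mul_self (i : V) : iRefl V τ i * iRefl V τ i = 1 :=
  LinearEquiv.ext (iRefl_iRefl hτ i)

omit hτ in
lemma iRefl_mem_weylGroup (i : V) : iRefl V τ i ∈ weylGroup V := by
  unfold iRefl
  split_ifs
  · exact simpleRefl_mem i
  · exact mul_mem (simpleRefl_mem i) (simpleRefl_mem _)

lemma iRefl_mem (i : V) : iRefl V τ i ∈ restrictedWeylGroup V τ := by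
  refine mem_restrictedWeylGroup_iff.2 ⟨iRefl_mem_weylGroup i, fun x => ?_⟩
  by_cases h : τ i = i
  · rw [iRefl_apply_of_eq h, iRefl_apply_of_eq h, latticePerm_simpleRefl hτ, h]
  · rw [iRefl_apply_of_ne h, iRefl_apply_of_ne h, latticePerm_simpleRefl hτ,
      latticePerm_simpleRefl hτ, hτ.apply_apply, simpleRefl_commute hτ h]

lemma latticePerm_iRefl (i : V) (x : V → ℤ) :
    latticePerm τ (iRefl V τ i x) = iRefl V τ i (latticePerm τ x) :=
  (mem_restrictedWeylGroup_iff.1 (iRefl_mem hτ i)).2 x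

lemma iRefl_simpleRoot (i : V) : iRefl V τ i (simpleRoot i) = -simpleRoot i := by
  by_cases h : τ i = i
  · rw [iRefl_apply_of_eq h, simpleRefl_simpleRoot]
  · rw [iRefl_apply_of_ne h, simpleRefl_orth' hτ h, simpleRefl_simpleRoot]

lemma iRefl_simpleRoot' (i : V) : iRefl V τ i (simpleRoot (τ i)) = -simpleRoot (τ i) := by
  rw [← latticePerm_simpleRoot, ← latticePerm_iRefl hτ, iRefl_simpleRoot hτ, map_neg]

lemma iRefl_apply_self (i : V) (x : V → ℤ) : iRefl V τ i x i = simpleRefl V i x i := by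
  by_cases h : τ i = i
  · rw [iRefl_apply_of_eq h]
  · rw [iRefl_apply_of_ne h, simpleRefl_commute hτ h, simpleRefl_apply_of_ne (Ne.symm h)]

omit hτ in
lemma iRefl_apply_self' (i : V) (x : V → ℤ) :
    iRefl V τ i x (τ i) = simpleRefl V (τ i) x (τ i) := by
  by_cases h : τ i = i
  · rw [iRefl_apply_of_eq h, h]
  · rw [iRefl_apply_of_ne h, simpleRefl_apply_of_ne h]

omit hτ in
lemma form_iRefl (i : V) (x y : V → ℤ) :
    form V (iRefl V τ i x) (iRefl V τ i y) = form V x y :=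
  form_of_mem_weylGroup (iRefl_mem_weylGroup i) x y

variable (hQ : IsDynkin V)

include hQ

/-- For a two-element orbit, s_{τ i} x can equal α_i only if x = α_i, as s_{τ i} fixes α_i. -/
lemma iRefl_nonneg {x : V → ℤ} (hx : form V x x = 2) (h : 0 ≤ x) {i : V}
    (hi : x ≠ simpleRoot i) (hi' : x ≠ simpleRoot (τ i)) : 0 ≤ iRefl V τ i x := by
  by_cases h0 : τ i = i
  · rw [iRefl_apply_of_eq h0]
    exact simpleRefl_nonneg hQ hx h hi
  · rw [iRefl_apply_of_ne h0]
    refine simpleRefl_nonneg hQ (by rwa [form_simpleRefl]) (simpleRefl_nonneg hQ hx h hi') ?_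
    intro h1
    apply hi
    rw [← simpleRefl_simpleRefl (τ i) x, h1, simpleRefl_orth' hτ h0]

omit [Fintype V] hτ hQ in
lemma nonneg_latticePerm_iff (hτ : IsDiagramInvolution τ) (x : V → ℤ) :
    0 ≤ latticePerm τ x ↔ 0 ≤ x :=
  ⟨fun h => latticePerm_latticePerm hτ x ▸ latticePerm_nonneg h, latticePerm_nonneg⟩

open scoped Classical in
omit hτ in
/-- The finite set of positive roots. -/
def posRootsFinset : Finset (V → ℤ) :=
  (finite_roots hQ).toFinset.filter fun x => 0 ≤ x

omit hτ in
lemma mem_posRootsFinset {x : V → ℤ} :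
    x ∈ posRootsFinset hQ ↔ form V x x = 2 ∧ 0 ≤ x := by
  simp [posRootsFinset]

open scoped Classical in
omit hτ in
/-- The inversion set of an element of the Weyl group. -/
def inversions (w : (V → ℤ) ≃ₗ[ℤ] (V → ℤ)) : Finset (V → ℤ) :=
  (posRootsFinset hQ).filter fun x => ¬ 0 ≤ w x

omit hτ in
lemma mem_inversions {w : (V → ℤ) ≃ₗ[ℤ] (V → ℤ)} {x : V → ℤ} :
    x ∈ inversions hQ w ↔ (form V x x = 2 ∧ 0 ≤ x) ∧ ¬ 0 ≤ w x := by
  simp [inversions, mem_posRootsFinset hQ]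

open scoped Classical in
omit hτ hQ in
/-- A root fixed by `τ` counts twice, any other root once. -/
def weight (τ : Equiv.Perm V) (x : V → ℤ) : ℕ := if latticePerm τ x = x then 2 else 1

omit hτ in
/-- Twice the number of `τ`-orbits of inversions. -/
def twiceLength (τ : Equiv.Perm V) (w : (V → ℤ) ≃ₗ[ℤ] (V → ℤ)) : ℕ :=
  ∑ x ∈ inversions hQ w, weight τ x

-- The reflection 𝐬_i permutes the positive roots outside {α_i, α_{τ i}}, so it carries inversions
-- of w to inversions of w 𝐬_i. The two excluded roots become inversions because w α_i, and with it
-- w α_{τ i}, is positive.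
open scoped Classical in
lemma inversions_mul_iRefl {w : (V → ℤ) ≃ₗ[ℤ] (V → ℤ)} (hw : w ∈ restrictedWeylGroup V τ) {i : V}
    (hi : 0 ≤ w (simpleRoot i)) :
    inversions hQ (w * iRefl V τ i) = (inversions hQ w).image (iRefl V τ i) ∪
      {simpleRoot i, simpleRoot (τ i)} ∧
    Disjoint ((inversions hQ w).image (iRefl V τ i))
      ({simpleRoot i, simpleRoot (τ i)} : Finset (V → ℤ)) := by
  obtain ⟨hwW, hwτ⟩ := mem_restrictedWeylGroup_iff.1 hw
  have hi' : 0 ≤ w (simpleRoot (τ i)) := by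
    rw [← latticePerm_simpleRoot, ← hwτ]
    exact latticePerm_nonneg hi
  have hneg : ∀ j, 0 ≤ w (simpleRoot j) → ¬ 0 ≤ w (-simpleRoot j) := fun j hj => by
    rw [map_neg]
    refine not_nonneg_neg ?_ hj
    rw [form_of_mem_weylGroup hwW, form_simpleRoot_self]
  have hinv : ∀ y ∈ inversions hQ w, iRefl V τ i y ≠ simpleRoot i ∧
      iRefl V τ i y ≠ simpleRoot (τ i) := by
    intro y hy
    rw [mem_inversions] at hy
    constructor
    · intro h
      rw [← iRefl_iRefl hτ i y, h, iRefl_simpleRoot hτ] at hy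
      exact not_nonneg_neg (form_simpleRoot_self i) (simpleRoot_nonneg i) hy.1.2
    · intro h
      rw [← iRefl_iRefl hτ i y, h, iRefl_simpleRoot' hτ] at hy
      exact not_nonneg_neg (form_simpleRoot_self _) (simpleRoot_nonneg _) hy.1.2
  constructor
  · ext x
    simp only [Finset.mem_union, Finset.mem_image, Finset.mem_insert, Finset.mem_singleton]
    constructor
    · intro hx
      by_cases h1 : x = simpleRoot i
      · exact Or.inr (Or.inl h1)
      by_cases h2 : x = simpleRoot (τ i)
      · exact Or.inr (Or.inr h2)
      rw [mem_inversions] at hx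
      refine Or.inl ⟨iRefl V τ i x, ?_, iRefl_iRefl hτ i x⟩
      rw [mem_inversions, form_iRefl]
      exact ⟨⟨hx.1.1, iRefl_nonneg hτ hQ hx.1.1 hx.1.2 h1 h2⟩, hx.2⟩
    · rintro (⟨y, hy, rfl⟩ | rfl | rfl)
      · have hy' := hy
        rw [mem_inversions] at hy ⊢
        rw [form_iRefl, LinearEquiv.mul_apply, iRefl_iRefl hτ]
        refine ⟨⟨hy.1.1, iRefl_nonneg hτ hQ hy.1.1 hy.1.2 ?_ ?_⟩, hy.2⟩
        · rintro rfl
          exact hy.2 hi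
        · rintro rfl
          exact hy.2 hi'
      · rw [mem_inversions, LinearEquiv.mul_apply, iRefl_simpleRoot hτ]
        exact ⟨⟨form_simpleRoot_self _, simpleRoot_nonneg _⟩, hneg _ hi⟩
      · rw [mem_inversions, LinearEquiv.mul_apply, iRefl_simpleRoot' hτ]
        exact ⟨⟨form_simpleRoot_self _, simpleRoot_nonneg _⟩, hneg _ hi'⟩
  · rw [Finset.disjoint_left]
    intro x hx
    obtain ⟨y, hy, rfl⟩ := Finset.mem_image.1 hx
    simp only [Finset.mem_insert, Finset.mem_singleton, not_or]
    exact hinv y hy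

/-- The weights make the increment uniform: the new orbit is one root of weight 2 or two roots of
weight 1. -/
lemma twiceLength_mul_iRefl {w : (V → ℤ) ≃ₗ[ℤ] (V → ℤ)} (hw : w ∈ restrictedWeylGroup V τ)
    {i : V} (hi : 0 ≤ w (simpleRoot i)) :
    twiceLength hQ τ (w * iRefl V τ i) = twiceLength hQ τ w + 2 := by
  classical
  obtain ⟨h1, h2⟩ := inversions_mul_iRefl hτ hQ hw hi
  rw [twiceLength, h1, Finset.sum_union h2, Finset.sum_image (iRefl V τ i).injective.injOn]
  congr 1
  · refine Finset.sum_congr rfl fun x _ => ?_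
    unfold weight
    simp only [latticePerm_iRefl hτ, (iRefl V τ i).injective.eq_iff]
  · by_cases h : τ i = i
    · rw [h, Finset.pair_eq_singleton, Finset.sum_singleton, weight,
        if_pos (by rw [latticePerm_simpleRoot, h])]
    · rw [Finset.sum_pair fun h' => h (simpleRoot_injective h').symm, weight, weight,
        latticePerm_simpleRoot, latticePerm_simpleRoot, hτ.apply_apply,
        if_neg fun h' => h (simpleRoot_injective h'),
        if_neg fun h' => h (simpleRoot_injective h').symm]

lemma nonneg_mul_iRefl {w : (V → ℤ) ≃ₗ[ℤ] (V → ℤ)} (hw : w ∈ restrictedWeylGroup V τ) {i : V}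
    (hi : ¬ 0 ≤ w (simpleRoot i)) : 0 ≤ (w * iRefl V τ i) (simpleRoot i) := by
  rw [LinearEquiv.mul_apply, iRefl_simpleRoot hτ, map_neg]
  refine (not_nonneg_iff hQ ?_).1 hi
  rw [form_of_mem_weylGroup (mem_restrictedWeylGroup_iff.1 hw).1, form_simpleRoot_self]

lemma twiceLength_mul_iRefl_of_neg {w : (V → ℤ) ≃ₗ[ℤ] (V → ℤ)}
    (hw : w ∈ restrictedWeylGroup V τ) {i : V} (hi : ¬ 0 ≤ w (simpleRoot i)) :
    twiceLength hQ τ (w * iRefl V τ i) + 2 = twiceLength hQ τ w := by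
  rw [← twiceLength_mul_iRefl hτ hQ (mul_mem hw (iRefl_mem hτ i))
    (nonneg_mul_iRefl hτ hQ hw hi), mul_assoc, iRefl_mul_self hτ, mul_one]

end

/-! ### Reduced expressions from a length function -/

/-- If a function on a group changes by at most two upon multiplication by a generator, and drops
by two for a suitable generator, then it is twice the length. -/
lemma isReducedExpr_iff_of_length {G J : Type} [Group G] {H : Subgroup G} {s : J → G}
    (hs : ∀ j, s j ∈ H) {n : G → ℕ} (h1 : n 1 = 0)
    (hup : ∀ g ∈ H, ∀ j, n (g * s j) ≤ n g + 2) (l : List J) (g : G)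
    (hg : (l.map s).prod = g) (hn : n g = 2 * l.length) : IsReducedExpr s l g := by
  refine ⟨hg, fun l' hl' => ?_⟩
  have key : ∀ l : List J, (l.map s).prod ∈ H ∧ n (l.map s).prod ≤ 2 * l.length := by
    intro l
    induction l using List.reverseRecOn with
    | nil => exact ⟨one_mem H, by simp [h1]⟩
    | append_singleton l j ih =>
      rw [List.map_append, List.prod_append, List.map_singleton, List.prod_singleton,
        List.length_append, List.length_singleton]
      exact ⟨mul_mem ih.1 (hs j), (hup _ ih.1 j).trans (by lia)⟩
  have := (key l').2
  rw [hl'] at this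
  lia

/-- Descent on n; each descending generator, being an involution, is put back at the right end of
the word. -/
lemma exists_expr_of_length {G J : Type} [Group G] {H : Subgroup G} {s : J → G}
    (hs : ∀ j, s j ∈ H) (hss : ∀ j, s j * s j = 1) {n : G → ℕ} (h1 : n 1 = 0)
    (hdown : ∀ g ∈ H, g ≠ 1 → ∃ j, n (g * s j) + 2 = n g) :
    ∀ g ∈ H, ∃ l : List J, (l.map s).prod = g ∧ n g = 2 * l.length := by
  intro g hg
  induction hm : n g using Nat.strong_induction_on generalizing g with
  | _ m ih =>
  by_cases h : g = 1
  · subst h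
    exact ⟨[], rfl, by rw [← hm, h1]; rfl⟩
  · obtain ⟨j, hj⟩ := hdown g hg h
    obtain ⟨l, hl, hlen⟩ := ih _ (by lia) (g * s j) (mul_mem hg (hs j)) rfl
    refine ⟨l ++ [j], ?_, ?_⟩
    · rw [List.map_append, List.prod_append, List.map_singleton, List.prod_singleton, hl,
        mul_assoc, hss, mul_one]
    · rw [List.length_append, List.length_singleton]
      lia

section

variable {V : Type} [Fintype V] [Quiver.{0} V] {τ : Equiv.Perm V} (hτ : IsDiagramInvolution τ)
  (hQ : IsDynkin V) {J : Type} (ι : J → V) (hι : ∀ i, ∃ j, ι j = i ∨ ι j = τ i)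

include hτ hQ

omit hτ in
lemma twiceLength_one : twiceLength hQ τ 1 = 0 := by
  refine Finset.sum_eq_zero fun x hx => ?_
  rw [mem_inversions] at hx
  exact absurd hx.1.2 hx.2

lemma isReducedExpr_iRefl (l : List J) {w : (V → ℤ) ≃ₗ[ℤ] (V → ℤ)}
    (hw : (l.map fun j => iRefl V τ (ι j)).prod = w) (hn : twiceLength hQ τ w = 2 * l.length) :
    IsReducedExpr (fun j => iRefl V τ (ι j)) l w := by
  refine isReducedExpr_iff_of_length (H := restrictedWeylGroup V τ) (fun j => iRefl_mem hτ (ι j))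
    (twiceLength_one hQ) (fun g hg j => ?_) l w hw hn
  by_cases h : 0 ≤ g (simpleRoot (ι j))
  · exact (twiceLength_mul_iRefl hτ hQ hg h).le
  · have := twiceLength_mul_iRefl_of_neg hτ hQ hg h
    lia

-- In particular the 𝐬_i at orbit representatives generate W_τ. A nontrivial w makes some α_i
-- negative, and as w commutes with τ the representative of the orbit of i is a descent too.
include hι in
lemma exists_expr_iRefl {w : (V → ℤ) ≃ₗ[ℤ] (V → ℤ)} (hw : w ∈ restrictedWeylGroup V τ) :
    ∃ l : List J, (l.map fun j => iRefl V τ (ι j)).prod = w ∧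
      twiceLength hQ τ w = 2 * l.length := by
  refine exists_expr_of_length (fun j => iRefl_mem hτ (ι j)) (fun j => iRefl_mul_self hτ (ι j))
    (twiceLength_one hQ) (fun g hg h1 => ?_) w hw
  obtain ⟨hgW, hgτ⟩ := mem_restrictedWeylGroup_iff.1 hg
  obtain ⟨i, hi⟩ : ∃ i, ¬ 0 ≤ g (simpleRoot i) := by
    by_contra! hcon
    exact h1 (eq_one_of_nonneg hQ hgW hcon)
  obtain ⟨j, hj⟩ := hι i
  refine ⟨j, twiceLength_mul_iRefl_of_neg hτ hQ hg ?_⟩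
  obtain hj | hj := hj
  · rwa [hj]
  · rwa [hj, ← latticePerm_simpleRoot, ← hgτ, nonneg_latticePerm_iff hτ]

-- Length is governed by the weighted inversion set, which for this w consists of all positive
-- roots.
include hι in
lemma isLongestElement_iRefl {w : (V → ℤ) ≃ₗ[ℤ] (V → ℤ)} (hw : w ∈ restrictedWeylGroup V τ)
    (hneg : ∀ x : V → ℤ, form V x x = 2 → 0 ≤ x → ¬ 0 ≤ w x) :
    IsLongestElement (restrictedWeylGroup V τ) (fun j => iRefl V τ (ι j)) w := by
  obtain ⟨l, hl, hlen⟩ := exists_expr_iRefl hτ hQ ι hι hw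
  refine ⟨hw, l, isReducedExpr_iRefl hτ hQ ι l hl hlen, fun g hg => ?_⟩
  obtain ⟨l', hl', hlen'⟩ := exists_expr_iRefl hτ hQ ι hι hg
  refine ⟨l', isReducedExpr_iRefl hτ hQ ι l' hl' hlen', ?_⟩
  have hsub : inversions hQ g ⊆ inversions hQ w := fun x hx => by
    rw [mem_inversions] at hx ⊢
    exact ⟨hx.1, hneg x hx.1.1 hx.1.2⟩
  have : twiceLength hQ τ g ≤ twiceLength hQ τ w := Finset.sum_le_sum_of_subset hsub
  lia

end


/-! ### Reversing arrows, in terms of arrow-counting matrices. -/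

section Reflect

variable {V : Type}

lemma reflect_hom_of_or (Q : Quiver.{0} V) {l i j : V} (h : i = l ∨ j = l) :
    (reflect Q l).Hom i j = Q.Hom j i := if_pos h

lemma reflect_hom_of_not_or (Q : Quiver.{0} V) {l i j : V} (h : ¬ (i = l ∨ j = l)) :
    (reflect Q l).Hom i j = Q.Hom i j := if_neg h

lemma finite_reflect {Q : Quiver.{0} V} (h : ∀ i j, Finite (Q.Hom i j)) (l i j : V) :
    Finite ((reflect Q l).Hom i j) := by
  by_cases hl : i = l ∨ j = l
  · rw [reflect_hom_of_or Q hl]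
    exact h j i
  · rw [reflect_hom_of_not_or Q hl]
    exact h i j

lemma finite_iReflect {Q : Quiver.{0} V} (τ : Equiv.Perm V) (h : ∀ i j, Finite (Q.Hom i j))
    (l i j : V) : Finite ((iReflect τ Q l).Hom i j) := by
  by_cases hl : τ l = l
  · rw [iReflect, if_pos hl]
    exact finite_reflect h l i j
  · rw [iReflect, if_neg hl]
    exact finite_reflect (finite_reflect h (τ l)) l i j

lemma arrowMatrix_reflect (Q : Quiver.{0} V) (l : V) :
    arrowMatrix (reflect Q l) = reflectMatrix (arrowMatrix Q) l := by
  funext i j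
  by_cases hl : i = l ∨ j = l
  · rw [arrowMatrix, reflect_hom_of_or Q hl, reflectMatrix, if_pos hl]
    rfl
  · rw [arrowMatrix, reflect_hom_of_not_or Q hl, reflectMatrix, if_neg hl]
    rfl

lemma arrowMatrix_iReflect_of_eq (Q : Quiver.{0} V) {τ : Equiv.Perm V} {l : V} (h : τ l = l) :
    arrowMatrix (iReflect τ Q l) = reflectMatrix (arrowMatrix Q) l := by
  rw [iReflect, if_pos h, arrowMatrix_reflect]

lemma arrowMatrix_iReflect_of_ne (Q : Quiver.{0} V) {τ : Equiv.Perm V} {l : V} (h : τ l ≠ l) :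
    arrowMatrix (iReflect τ Q l) = reflectMatrix (reflectMatrix (arrowMatrix Q) (τ l)) l := by
  rw [iReflect, if_neg h, arrowMatrix_reflect, arrowMatrix_reflect]

lemma isSink_iff {Q : Quiver.{0} V} (h : ∀ i j, Finite (Q.Hom i j)) (i : V) :
    IsSink Q i ↔ ∀ j, arrowMatrix Q i j = 0 := by
  refine forall_congr' fun j => ?_
  have := h i j
  rw [arrowMatrix, Int.natCast_eq_zero, Finite.card_eq_zero_iff]

lemma IsIAdmissible.append_singleton {Q : Quiver.{0} V} {τ : Equiv.Perm V} {l : List V}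
    (h : IsIAdmissible Q τ l) {i : V} (hi : IsSink (l.foldl (iReflect τ) Q) i) :
    IsIAdmissible Q τ (l ++ [i]) := by
  intro r hr
  rw [List.length_append, List.length_singleton] at hr
  by_cases hrl : r < l.length
  · rw [List.take_append_of_le_length hrl.le, List.getElem_append_left hrl]
    exact h r hrl
  · obtain rfl : r = l.length := by lia
    rw [List.take_left', List.getElem_append_right le_rfl]
    · simpa using hi
    · rfl

lemma reflectMatrix_of_or (n : Matrix V V ℤ) {l i j : V} (h : i = l ∨ j = l) :
    reflectMatrix n l i j = n j i := if_pos h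

lemma reflectMatrix_of_not_or (n : Matrix V V ℤ) {l i j : V} (h : ¬ (i = l ∨ j = l)) :
    reflectMatrix n l i j = n i j := if_neg h

lemma reflectMatrix_reflectMatrix_symm {τ : Equiv.Perm V} (hττ : ∀ i, τ (τ i) = i)
    {n : Matrix V V ℤ} (hn : ∀ i j, n (τ i) (τ j) = n i j) (l i j : V) :
    reflectMatrix (reflectMatrix n (τ l)) l (τ i) (τ j) =
      reflectMatrix (reflectMatrix n (τ l)) l i j := by
  have h : ∀ a b, τ a = b ↔ a = τ b := fun a b =>
    ⟨fun h => by rw [← h, hττ], fun h => by rw [h, hττ]⟩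
  have hA : τ i = τ l ∨ τ j = τ l ↔ i = l ∨ j = l := by
    rw [τ.injective.eq_iff, τ.injective.eq_iff]
  have hB : τ i = l ∨ τ j = l ↔ i = τ l ∨ j = τ l := by rw [h, h]
  by_cases h1 : i = l ∨ j = l <;> by_cases h2 : i = τ l ∨ j = τ l
  · rw [reflectMatrix_of_or _ (hB.2 h2), reflectMatrix_of_or _ (hA.2 h1).symm,
      reflectMatrix_of_or _ h1, reflectMatrix_of_or _ h2.symm, hn]
  · rw [reflectMatrix_of_not_or _ (hB.not.2 h2), reflectMatrix_of_or _ (hA.2 h1),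
      reflectMatrix_of_or _ h1, reflectMatrix_of_not_or _ fun h => h2 h.symm, hn]
  · rw [reflectMatrix_of_or _ (hB.2 h2), reflectMatrix_of_not_or _ fun h => h1 (hA.1 h.symm),
      reflectMatrix_of_not_or _ h1, reflectMatrix_of_or _ h2, hn]
  · rw [reflectMatrix_of_not_or _ (hB.not.2 h2), reflectMatrix_of_not_or _ (hA.not.2 h1),
      reflectMatrix_of_not_or _ h1, reflectMatrix_of_not_or _ h2, hn]

lemma reflectMatrix_symm {τ : Equiv.Perm V} {n : Matrix V V ℤ}
    (hn : ∀ i j, n (τ i) (τ j) = n i j) {l : V} (hl : τ l = l) (i j : V) :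
    reflectMatrix n l (τ i) (τ j) = reflectMatrix n l i j := by
  have h : ∀ a, τ a = l ↔ a = l := fun a =>
    ⟨fun h => τ.injective (h.trans hl.symm), fun h => by rw [h, hl]⟩
  have hA : τ i = l ∨ τ j = l ↔ i = l ∨ j = l := by rw [h, h]
  by_cases h1 : i = l ∨ j = l
  · rw [reflectMatrix_of_or _ (hA.2 h1), reflectMatrix_of_or _ h1, hn]
  · rw [reflectMatrix_of_not_or _ (hA.not.2 h1), reflectMatrix_of_not_or _ h1, hn]

end Reflect

/-! ### Words in the 𝐬_i and their root lists, extended by one letter. -/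

section Words

variable {V : Type} [Fintype V] [Quiver.{0} V] (τ : Equiv.Perm V)

/-- The element of the Weyl group given by a word in the generators `𝐬 i`. -/
abbrev wordProd (l : List V) : (V → ℤ) ≃ₗ[ℤ] (V → ℤ) := (l.map (iRefl V τ)).prod

lemma wordProd_append_singleton (l : List V) (i : V) :
    wordProd τ (l ++ [i]) = wordProd τ l * iRefl V τ i := by
  simp [wordProd]

open scoped Classical in
lemma betaList_append_singleton (l : List V) (i : V) :
    betaList τ (l ++ [i]) = betaList τ l ++
      if latticePerm τ (wordProd τ l (simpleRoot i)) = wordProd τ l (simpleRoot i) then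
        [wordProd τ l (simpleRoot i)]
      else [wordProd τ l (simpleRoot i), latticePerm τ (wordProd τ l (simpleRoot i))] := by
  let F : (V → ℤ) → List (V → ℤ) := fun b => if latticePerm τ b = b then [b]
    else [b, latticePerm τ b]
  -- Written with `List.ofFn`, the list can be split at its last index.
  have hF : ∀ l : List V, betaList τ l =
      (List.ofFn fun j : Fin l.length => F (beta τ l j)).flatten := fun l => by
    rw [betaList, List.flatMap_def, List.ofFn_eq_map]
  rw [hF, hF, List.ofFn_congr (List.length_append.trans (by rw [List.length_singleton])),
    List.ofFn_succ', List.concat_eq_append, List.flatten_append, List.flatten_singleton]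
  congr 3
  · funext j
    simp [beta, List.take_append_of_le_length j.2.le]
  · simp [beta]

omit [Fintype V] [Quiver.{0} V] in
lemma expand_append_singleton (l : List V) (i : V) :
    expand τ (l ++ [i]) = expand τ l ++ expand τ [i] := by
  simp [expand]

end Words


/-! ### Symmetric reversal at an orbit of sinks, and existence of sinks. -/

section Orientation

variable {V : Type} {Q' : Quiver.{0} V} [Quiver.{0} V] {τ : Equiv.Perm V} {n : Matrix V V ℤ}

omit [Quiver.{0} V] in
lemma reflectMatrix_eq_zero {l i : V} (hl : ∀ j, n l j = 0) (hi : ∀ j, n i j = 0) (hil : i ≠ l)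
    (j : V) : reflectMatrix n l i j = 0 := by
  by_cases h : j = l
  · rw [reflectMatrix_of_or n (Or.inr h), h, hl]
  · rw [reflectMatrix_of_not_or n (by tauto), hi]

omit [Quiver.{0} V] in
lemma eq_zero_of_symm (hn : ∀ i j, n (τ i) (τ j) = n i j) {l : V} (hl : ∀ j, n l j = 0) (j : V) :
    n (τ l) j = 0 := by
  rw [← τ.apply_symm_apply j, hn, hl]

lemma isOrientation_iReflect (hn : IsOrientation (arrowMatrix Q')) (l : V) :
    IsOrientation (arrowMatrix (iReflect τ Q' l)) := by
  by_cases h : τ l = l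
  · rw [arrowMatrix_iReflect_of_eq _ h]
    exact hn.reflect l
  · rw [arrowMatrix_iReflect_of_ne _ h]
    exact (hn.reflect _).reflect l

variable [Fintype V] (hτ : IsDiagramInvolution τ)

include hτ

omit [Fintype V] in
lemma arrowMatrix_iReflect_symm
    (hs : ∀ i j, arrowMatrix Q' (τ i) (τ j) = arrowMatrix Q' i j) (l i j : V) :
    arrowMatrix (iReflect τ Q' l) (τ i) (τ j) = arrowMatrix (iReflect τ Q' l) i j := by
  by_cases h : τ l = l
  · rw [arrowMatrix_iReflect_of_eq _ h]
    exact reflectMatrix_symm hs h i j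
  · rw [arrowMatrix_iReflect_of_ne _ h]
    exact reflectMatrix_reflectMatrix_symm hτ.apply_apply hs l i j

/-- For a two-element orbit, apply the one-sink isometry twice: by symmetry τ l is also a sink, and
l remains one after the reversal at τ l. -/
lemma euler_iReflect (hn : IsOrientation (arrowMatrix Q'))
    (hs : ∀ i j, arrowMatrix Q' (τ i) (τ j) = arrowMatrix Q' i j) {l : V}
    (hl : ∀ j, arrowMatrix Q' l j = 0) (x y : V → ℤ) :
    euler (arrowMatrix (iReflect τ Q' l)) x y =
      euler (arrowMatrix Q') (iRefl V τ l x) (iRefl V τ l y) := by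
  by_cases h : τ l = l
  · rw [arrowMatrix_iReflect_of_eq _ h, hn.euler_reflectMatrix hl, iRefl_apply_of_eq h,
      iRefl_apply_of_eq h]
  · have hl' := eq_zero_of_symm hs hl
    rw [arrowMatrix_iReflect_of_ne _ h, (hn.reflect _).euler_reflectMatrix
      (reflectMatrix_eq_zero hl' hl (Ne.symm h)), hn.euler_reflectMatrix hl',
      iRefl_apply_of_ne h, iRefl_apply_of_ne h, simpleRefl_commute hτ h, simpleRefl_commute hτ h]

omit hτ in
-- This is the source of the ordering: a vector that stays nonnegative after s_l pairs nonpositively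
-- with α_l on its right.
lemma euler_simpleRoot_eq_neg_simpleRefl (hn : IsOrientation n) {l : V} (hl : ∀ j, n l j = 0)
    (x : V → ℤ) : euler n x (simpleRoot l) = -simpleRefl V l x l := by
  rw [hn.euler_simpleRoot_right_of_sink hl, simpleRefl_apply]
  simp only [Pi.sub_apply, Pi.smul_apply, simpleRoot_self, smul_eq_mul]
  ring

omit hτ in
/-- In a Dynkin quiver, a nonempty set of vertices which is closed under arrows contains a
sink. -/
lemma exists_sink_of_closed (hQ : IsDynkin V) (hn : IsOrientation n) (P : Set V)
    (hP : P.Nonempty) (hcl : ∀ i ∈ P, ∀ j, n i j ≠ 0 → j ∈ P) : ∃ i ∈ P, ∀ j, n i j = 0 := by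
  classical
  by_contra! hcon
  -- Without a sink, every vertex of P has an arrow ending in P, so the indicator vector has Euler
  -- norm at most |P| − |P| = 0.
  let v : V → ℤ := fun i => if i ∈ P then 1 else 0
  have hv0 : ∀ i, 0 ≤ v i := fun i => by
    by_cases hi : i ∈ P <;> simp [v, hi]
  obtain ⟨i₀, hi₀⟩ := hP
  have hv : v ≠ 0 := fun h => by
    have h1 : v i₀ = 0 := congrFun h i₀
    simp [v, hi₀] at h1
  have hpos := form_pos hQ hv
  rw [hn.form_self, euler_apply, ← Finset.sum_sub_distrib] at hpos
  have hle : ∑ i, (v i * v i - ∑ j, n i j * (v i * v j)) ≤ 0 := by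
    refine Finset.sum_nonpos fun i _ => ?_
    by_cases hi : i ∈ P
    · obtain ⟨j, hj⟩ := hcon i hi
      have hvi : v i = 1 := if_pos hi
      have hvj : v j = 1 := if_pos (hcl i hi j hj)
      have hnn : ∀ k, 0 ≤ n i k * (v i * v k) := fun k =>
        mul_nonneg (hn.nonneg i k) (mul_nonneg (hv0 i) (hv0 k))
      have h1 := Finset.single_le_sum (f := fun k => n i k * (v i * v k)) (fun k _ => hnn k)
        (Finset.mem_univ j)
      simp only [hvi, hvj] at h1 ⊢
      have h2 := hn.nonneg i j
      lia
    · have hvi : v i = 0 := if_neg hi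
      simp [hvi]
  lia

end Orientation

/-! ### The greedy construction of the sequence. -/

section Greedy

variable {V : Type} [Fintype V] [Q : Quiver.{0} V] {τ : Equiv.Perm V} (hQ : IsDynkin V)
  (hτ : IsDiagramInvolution τ)

lemma wordProd_mem (hτ : IsDiagramInvolution τ) (l : List V) :
    wordProd τ l ∈ restrictedWeylGroup V τ :=
  Subgroup.list_prod_mem _ fun x hx => by
    obtain ⟨i, -, rfl⟩ := List.mem_map.1 hx
    exact iRefl_mem hτ i

/-- The properties of an `ı`-admissible sequence whose associated word is reduced. -/
structure IsAdapted (hQ : IsDynkin V) (τ : Equiv.Perm V) (l : List V) : Prop where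
  admissible : IsIAdmissible Q τ l
  finite : ∀ i j, Finite ((l.foldl (iReflect τ) Q).Hom i j)
  orientation : IsOrientation (arrowMatrix (l.foldl (iReflect τ) Q))
  symm : ∀ i j, arrowMatrix (l.foldl (iReflect τ) Q) (τ i) (τ j) =
    arrowMatrix (l.foldl (iReflect τ) Q) i j
  euler_eq : ∀ x y, euler (arrowMatrix (l.foldl (iReflect τ) Q)) x y =
    euler (arrowMatrix Q) (wordProd τ l x) (wordProd τ l y)
  nodup : (betaList τ l).Nodup
  mem_iff : ∀ y, wordProd τ l y ∈ betaList τ l ↔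
    form V y y = 2 ∧ 0 ≤ wordProd τ l y ∧ ¬ 0 ≤ y
  pairwise : (betaList τ l).Pairwise fun a b => euler (arrowMatrix Q) b a ≤ 0
  remaining : ∀ y, form V y y = 2 → 0 ≤ y → 0 ≤ wordProd τ l y → ∀ a ∈ betaList τ l,
    euler (arrowMatrix Q) (wordProd τ l y) a ≤ 0
  length : twiceLength hQ τ (wordProd τ l) = 2 * l.length
  length_expand : (betaList τ l).length = (expand τ l).length

lemma isAdapted_nil (hs : ∀ i j, arrowMatrix Q (τ i) (τ j) = arrowMatrix Q i j) :
    IsAdapted hQ τ [] where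
  admissible r h := absurd h (Nat.not_lt_zero r)
  finite := hQ.finite_arrows
  orientation := hQ.isOrientation
  symm := hs
  euler_eq _ _ := rfl
  nodup := List.nodup_nil
  mem_iff _ := ⟨fun h => absurd h List.not_mem_nil, fun h => absurd h.2.1 h.2.2⟩
  pairwise := List.Pairwise.nil
  remaining _ _ _ _ _ h := absurd h List.not_mem_nil
  length := twiceLength_one hQ
  length_expand := rfl

namespace IsAdapted

variable {hQ} {l : List V} (h : IsAdapted hQ τ l)

include hτ h

/-- The field `remaining` drives the induction: applied to α_i and α_{τ i} it orders the new roots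
after the old ones, and it survives because a root still missing afterwards is nonnegative after
𝐬_i. -/
lemma append_singleton {i : V} (hi : ∀ j, arrowMatrix (l.foldl (iReflect τ) Q) i j = 0)
    (hpos : 0 ≤ wordProd τ l (simpleRoot i)) : IsAdapted hQ τ (l ++ [i]) := by
  classical
  have hwW := (mem_restrictedWeylGroup_iff.1 (wordProd_mem hτ l)).1
  have hwτ := (mem_restrictedWeylGroup_iff.1 (wordProd_mem hτ l)).2
  have hfold : (l ++ [i]).foldl (iReflect τ) Q = iReflect τ (l.foldl (iReflect τ) Q) i := by
    rw [List.foldl_append]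
    rfl
  have hi' := eq_zero_of_symm h.symm hi
  have hTβ : latticePerm τ (wordProd τ l (simpleRoot i)) = wordProd τ l (simpleRoot (τ i)) := by
    rw [hwτ, latticePerm_simpleRoot]
  have hpos' : 0 ≤ wordProd τ l (simpleRoot (τ i)) := hTβ ▸ latticePerm_nonneg hpos
  have hneg : ∀ j, 0 ≤ wordProd τ l (simpleRoot j) → ¬ 0 ≤ wordProd τ l (-simpleRoot j) :=
    fun j hj => by
      rw [map_neg]
      refine not_nonneg_neg ?_ hj
      rw [form_of_mem_weylGroup hwW, form_simpleRoot_self]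
  have hnot : ∀ j, 0 ≤ wordProd τ l (simpleRoot j) →
      wordProd τ l (simpleRoot j) ∉ betaList τ l := fun j _ hj =>
    ((h.mem_iff _).1 hj).2.2 (simpleRoot_nonneg j)
  obtain ⟨new, hnew, hmem, hnodup, hpw, hlen⟩ : ∃ new : List (V → ℤ),
      betaList τ (l ++ [i]) = betaList τ l ++ new ∧
      (∀ a, a ∈ new ↔ a = wordProd τ l (simpleRoot i) ∨ a = wordProd τ l (simpleRoot (τ i))) ∧
      new.Nodup ∧ new.Pairwise (fun a b => euler (arrowMatrix Q) b a ≤ 0) ∧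
      new.length = (expand τ [i]).length := by
    refine ⟨_, betaList_append_singleton τ l i, ?_⟩
    rw [hTβ]
    by_cases hii : τ i = i
    · rw [hii, if_pos rfl]
      simp [expand, hii]
    · have hne : wordProd τ l (simpleRoot (τ i)) ≠ wordProd τ l (simpleRoot i) := fun h' =>
        hii (simpleRoot_injective ((wordProd τ l).injective h'))
      rw [if_neg hne]
      refine ⟨by simp, by simpa using hne.symm, ?_, by simp [expand, hii]⟩
      -- Pulled back by w, the pairing of τ β with β is that of α_{τ i} with α_i, which is zero
      -- since τ i is a sink.
      rw [List.pairwise_pair, ← h.euler_eq, euler_simpleRoot_of_sink hi', simpleRoot_of_ne hii]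
  have hnewle : ∀ z, 0 ≤ iRefl V τ i z → ∀ a ∈ new,
      euler (arrowMatrix Q) (wordProd τ l z) a ≤ 0 := by
    intro z hz a ha
    obtain rfl | rfl := (hmem a).1 ha
    · rw [← h.euler_eq, euler_simpleRoot_eq_neg_simpleRefl h.orientation hi,
        ← iRefl_apply_self hτ]
      exact neg_nonpos.2 (hz i)
    · rw [← h.euler_eq, euler_simpleRoot_eq_neg_simpleRefl h.orientation hi',
        ← iRefl_apply_self']
      exact neg_nonpos.2 (hz (τ i))
  -- This is `mem_iff` for the longer word, expressed in the old coordinates z = 𝐬_i y.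
  have hmem' : ∀ z, wordProd τ l z ∈ betaList τ l ++ new ↔
      form V z z = 2 ∧ 0 ≤ wordProd τ l z ∧ ¬ 0 ≤ iRefl V τ i z := by
    intro z
    rw [List.mem_append, h.mem_iff, hmem, (wordProd τ l).injective.eq_iff,
      (wordProd τ l).injective.eq_iff]
    constructor
    · rintro (⟨hz, hwz, hz0⟩ | rfl | rfl)
      · refine ⟨hz, hwz, fun hs => ?_⟩
        have hz' : form V (-z) (-z) = 2 := by simpa using hz
        have h1 := iRefl_nonneg hτ hQ (i := i) hz' ((not_nonneg_iff hQ hz).1 hz0)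
          (fun he => hneg i hpos (by rwa [← he, neg_neg]))
          (fun he => hneg (τ i) hpos' (by rwa [← he, neg_neg]))
        rw [map_neg] at h1
        exact not_nonneg_neg (by rwa [form_iRefl]) hs h1
      · rw [iRefl_simpleRoot hτ]
        exact ⟨form_simpleRoot_self _, hpos,
          not_nonneg_neg (form_simpleRoot_self _) (simpleRoot_nonneg _)⟩
      · rw [iRefl_simpleRoot' hτ]
        exact ⟨form_simpleRoot_self _, hpos',
          not_nonneg_neg (form_simpleRoot_self _) (simpleRoot_nonneg _)⟩
    · rintro ⟨hz, hwz, hs⟩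
      by_cases h1 : z = simpleRoot i
      · exact Or.inr (Or.inl h1)
      by_cases h2 : z = simpleRoot (τ i)
      · exact Or.inr (Or.inr h2)
      exact Or.inl ⟨hz, hwz, fun hz0 => hs (iRefl_nonneg hτ hQ hz hz0 h1 h2)⟩
  have hw' : ∀ y, wordProd τ (l ++ [i]) y = wordProd τ l (iRefl V τ i y) := fun y => by
    rw [wordProd_append_singleton]
    rfl
  exact
    { admissible := h.admissible.append_singleton ((isSink_iff h.finite i).2 hi)
      finite := by
        rw [hfold]
        exact finite_iReflect τ h.finite i
      orientation := by
        rw [hfold]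
        exact isOrientation_iReflect h.orientation i
      symm := by
        rw [hfold]
        exact arrowMatrix_iReflect_symm hτ h.symm i
      euler_eq := fun x y => by
        rw [hfold, euler_iReflect hτ h.orientation h.symm hi, h.euler_eq, hw', hw']
      nodup := by
        rw [hnew, List.nodup_append']
        refine ⟨h.nodup, hnodup, fun a ha ha' => ?_⟩
        obtain rfl | rfl := (hmem a).1 ha'
        · exact hnot i hpos ha
        · exact hnot (τ i) hpos' ha
      mem_iff := fun y => by
        rw [hnew, hw', hmem', iRefl_iRefl hτ, form_iRefl]
      pairwise := by
        rw [hnew, List.pairwise_append]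
        refine ⟨h.pairwise, hpw, fun a ha b hb => ?_⟩
        obtain rfl | rfl := (hmem b).1 hb
        · exact h.remaining _ (form_simpleRoot_self _) (simpleRoot_nonneg _) hpos a ha
        · exact h.remaining _ (form_simpleRoot_self _) (simpleRoot_nonneg _) hpos' a ha
      remaining := fun y hy hy0 hwy a ha => by
        rw [hw'] at hwy ⊢
        rw [hnew, List.mem_append] at ha
        obtain ha | ha := ha
        · refine h.remaining _ (by rwa [form_iRefl]) ?_ hwy a ha
          refine iRefl_nonneg hτ hQ hy hy0 ?_ ?_
          · rintro rfl
            rw [iRefl_simpleRoot hτ] at hwy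
            exact hneg i hpos hwy
          · rintro rfl
            rw [iRefl_simpleRoot' hτ] at hwy
            exact hneg (τ i) hpos' hwy
        · exact hnewle _ (by rwa [iRefl_iRefl hτ]) a ha
      length := by
        rw [wordProd_append_singleton,
          twiceLength_mul_iRefl hτ hQ (wordProd_mem hτ l) hpos, h.length, List.length_append,
          List.length_singleton]
        ring
      length_expand := by
        rw [hnew, expand_append_singleton, List.length_append, List.length_append,
          h.length_expand, hlen] }

/-- If a positive root remains, there is a sink at which the sequence can be extended. -/
lemma exists_next {I : Set V} (hI : ∀ i, ∃ j ∈ I, j = i ∨ j = τ i) {x : V → ℤ}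
    (hx : form V x x = 2) (hx0 : 0 ≤ x) (hwx : 0 ≤ wordProd τ l x) :
    ∃ i ∈ I, (∀ j, arrowMatrix (l.foldl (iReflect τ) Q) i j = 0) ∧
      0 ≤ wordProd τ l (simpleRoot i) := by
  have hwW := (mem_restrictedWeylGroup_iff.1 (wordProd_mem hτ l)).1
  have hwτ := (mem_restrictedWeylGroup_iff.1 (wordProd_mem hτ l)).2
  have hroot : ∀ j, form V (wordProd τ l (simpleRoot j)) (wordProd τ l (simpleRoot j)) = 2 :=
    fun j => by rw [form_of_mem_weylGroup hwW, form_simpleRoot_self]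
  obtain ⟨i, hiP, hi⟩ := exists_sink_of_closed hQ h.orientation
    -- Nonempty: if w made all simple roots negative, it would make x negative as well.
    {j | 0 ≤ wordProd τ l (simpleRoot j)} (by
      by_contra! hcon
      have hneg : ∀ j, 0 ≤ -wordProd τ l (simpleRoot j) := fun j =>
        (not_nonneg_iff hQ (hroot j)).1 fun hj => (hcon ▸ Set.notMem_empty j) hj
      refine not_nonneg_neg (by rwa [form_of_mem_weylGroup hwW]) hwx ?_
      rw [eq_sum_simpleRoot x, map_sum, ← Finset.sum_neg_distrib]
      refine Finset.sum_nonneg fun j _ => ?_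
      rw [map_smul, ← smul_neg]
      exact smul_nonneg (hx0 j) (hneg j)) (by
      -- Closed under arrows: if w α_j were negative, −w α_j would already be listed, and
      -- `remaining` for α_i would give n_ij = ⟨w α_i, −w α_j⟩ ≤ 0, so there would be no arrow from
      -- i to j.
      intro i hi j hij
      by_contra hj
      have hne : i ≠ j := by
        rintro rfl
        exact hij (h.orientation.diag i)
      have hj' : 0 ≤ wordProd τ l (-simpleRoot j) := by
        rw [map_neg]
        exact (not_nonneg_iff hQ (hroot j)).1 hj
      have hmem : wordProd τ l (-simpleRoot j) ∈ betaList τ l :=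
        (h.mem_iff _).2 ⟨by simpa using form_simpleRoot_self j, hj',
          not_nonneg_neg (form_simpleRoot_self j) (simpleRoot_nonneg j)⟩
      have hle := h.remaining _ (form_simpleRoot_self i) (simpleRoot_nonneg i) hi _ hmem
      rw [← h.euler_eq, map_neg, euler_simpleRoot_simpleRoot _ i j hne, neg_neg] at hle
      exact hij (le_antisymm hle (h.orientation.nonneg i j)))
  obtain ⟨j, hjI, hj⟩ := hI i
  refine ⟨j, hjI, ?_⟩
  obtain rfl | rfl := hj
  · exact ⟨hi, hiP⟩
  · refine ⟨eq_zero_of_symm h.symm hi, ?_⟩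
    rw [← latticePerm_simpleRoot, ← hwτ]
    exact latticePerm_nonneg hiP

end IsAdapted

include hτ in
/-- There is an `ı`-admissible sequence exhausting the positive roots. -/
lemma exists_isAdapted (hs : ∀ i j, arrowMatrix Q (τ i) (τ j) = arrowMatrix Q i j) {I : Set V}
    (hI : ∀ i, ∃ j ∈ I, j = i ∨ j = τ i) :
    ∃ l : List V, (∀ i ∈ l, i ∈ I) ∧ IsAdapted hQ τ l ∧
      ∀ x, form V x x = 2 → 0 ≤ x → ¬ 0 ≤ wordProd τ l x := by
  by_contra! hcon
  have hall : ∀ m : ℕ, ∃ l : List V, (∀ i ∈ l, i ∈ I) ∧ IsAdapted hQ τ l ∧ l.length = m := by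
    intro m
    induction m with
    | zero => exact ⟨[], by simp, isAdapted_nil hQ hs, rfl⟩
    | succ m ih =>
      obtain ⟨l, hlI, hl, rfl⟩ := ih
      obtain ⟨x, hx, hx0, hwx⟩ := hcon l hlI hl
      obtain ⟨i, hiI, hi, hpos⟩ := hl.exists_next hτ hI hx hx0 hwx
      refine ⟨l ++ [i], ?_, hl.append_singleton hτ hi hpos, by simp⟩
      intro j hj
      obtain hj | hj := List.mem_append.1 hj
      · exact hlI j hj
      · rw [List.mem_singleton] at hj
        exact hj ▸ hiI
  -- Twice the length of an adapted sequence is at most the total weight of the positive roots, so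
  -- this length is impossible.
  obtain ⟨l, -, hl, hlen⟩ := hall (∑ x ∈ posRootsFinset hQ, weight τ x + 1)
  have h1 := hl.length
  have h2 : twiceLength hQ τ (wordProd τ l) ≤ ∑ x ∈ posRootsFinset hQ, weight τ x :=
    Finset.sum_le_sum_of_subset fun x hx => (mem_posRootsFinset hQ).2 ((mem_inversions hQ).1 hx).1
  lia

end Greedy


/-! ### Quiver involutions induce diagram involutions. -/

namespace Involution

variable {V : Type} [Q : Quiver.{0} V] (τ : Involution V)

lemma perm_perm (i : V) : τ.perm (τ.perm i) = i :=
  congrArg (fun F : V ⥤q V => F.obj i) τ.comp_self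

lemma map_injective {i j : V} :
    Function.Injective (fun a : i ⟶ j => τ.toPrefunctor.map a) := by
  -- `comp_self` equates prefunctors, so arrows are compared only heterogeneously; a variable F lets
  -- the equation be substituted.
  have key : ∀ F : V ⥤q V, F = 𝟭q V → ∀ a : i ⟶ j, HEq (F.map a) a := by
    rintro F rfl a
    rfl
  intro a b hab
  have hab' : (τ.toPrefunctor ⋙q τ.toPrefunctor).map a =
      (τ.toPrefunctor ⋙q τ.toPrefunctor).map b := congrArg τ.toPrefunctor.map hab
  exact eq_of_heq ((key _ τ.comp_self a).symm.trans
    ((heq_of_eq hab').trans (key _ τ.comp_self b)))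

lemma card_hom [Fintype V] (hQ : IsDynkin V) (i j : V) :
    Nat.card (τ.perm i ⟶ τ.perm j) = Nat.card (i ⟶ j) := by
  have hle : ∀ i j : V, Nat.card (i ⟶ j) ≤ Nat.card (τ.perm i ⟶ τ.perm j) := fun i j => by
    have := hQ.finite_arrows (τ.perm i) (τ.perm j)
    exact Nat.card_le_card_of_injective (β := (τ.perm i ⟶ τ.perm j)) _ τ.map_injective
  refine le_antisymm ?_ (hle i j)
  have h := hle (τ.perm i) (τ.perm j)
  rwa [τ.perm_perm, τ.perm_perm] at h

/-- An arrow from i to τ i and its image from τ i to i would form an oriented cycle. Hence s_i and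
s_{τ i} commute when τ i ≠ i. -/
lemma isEmpty_hom [Fintype V] (hQ : IsDynkin V) (i : V) : IsEmpty (i ⟶ τ.perm i) := by
  refine ⟨fun a => ?_⟩
  have h : τ.perm (τ.perm i) = i := τ.perm_perm i
  have b : τ.perm i ⟶ τ.perm (τ.perm i) := τ.toPrefunctor.map a
  rw [h] at b
  have := hQ.acyclic i (a.toPath.cons b)
  simp at this

lemma isDiagramInvolution [Fintype V] (hQ : IsDynkin V) : IsDiagramInvolution τ.perm where
  apply_apply := τ.perm_perm
  cartan i j := by
    by_cases h : i = j
    · rw [h, cartan_self, cartan_self]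
    · rw [IQuiver.cartan, IQuiver.cartan, if_neg h, if_neg fun h' => h (τ.perm.injective h'),
        τ.card_hom hQ, τ.card_hom hQ]
  orth i h := by
    have h1 := τ.isEmpty_hom hQ i
    have h2 := τ.isEmpty_hom hQ (τ.perm i)
    rw [τ.perm_perm] at h2
    rw [IQuiver.cartan, if_neg (Ne.symm h), Nat.card_of_isEmpty, Nat.card_of_isEmpty]
    rfl

end Involution

/-! ### The identity involution, and assembly of the theorem. -/

section Final

variable {V : Type} [Fintype V] [Q : Quiver.{0} V]

omit [Fintype V] in
lemma isDiagramInvolution_one : IsDiagramInvolution (1 : Equiv.Perm V) where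
  apply_apply _ := rfl
  cartan _ _ := rfl
  orth _ h := absurd rfl h

lemma iRefl_one (i : V) : iRefl V 1 i = simpleRefl V i := if_pos rfl

lemma restrictedWeylGroup_one : restrictedWeylGroup V 1 = weylGroup V := by
  ext w
  rw [mem_restrictedWeylGroup_iff]
  exact and_iff_left fun x => rfl

lemma prod_expand (τ : Equiv.Perm V) (l : List V) :
    ((expand τ l).map (simpleRefl V)).prod = wordProd τ l := by
  induction l with
  | nil => rfl
  | cons i l ih =>
    have h : expand τ (i :: l) = expand τ [i] ++ expand τ l := by simp [expand]
    rw [h, List.map_append, List.prod_append, ih]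
    refine congrArg (· * wordProd τ l) ?_
    by_cases hi : τ i = i <;> simp [expand, iRefl, hi]

end Final

end
end IQuiver

open IQuiver in
theorem theoremE {V : Type} [Fintype V] [Q : Quiver.{0} V] (hQ : IQuiver.IsDynkin V)
    (τ : IQuiver.Involution V) (I : Set V) (hI : IQuiver.IsOrbitReps τ.perm I) :
    ∃ seq : List I,
      IQuiver.IsIAdmissible Q τ.perm (seq.map Subtype.val) ∧
      (∀ (k : Type u) [Field k],
        IQuiver.IsQAdmissible k V (IQuiver.betaList τ.perm (seq.map Subtype.val))) ∧
      ∃ w₀ : (V → ℤ) ≃ₗ[ℤ] (V → ℤ),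
        IQuiver.IsLongestElement (IQuiver.weylGroup V) (IQuiver.simpleRefl V) w₀ ∧
        IQuiver.IsLongestElement (IQuiver.restrictedWeylGroup V τ.perm)
          (fun i : I => IQuiver.iRefl V τ.perm i) w₀ ∧
        IQuiver.IsReducedExpr (fun i : I => IQuiver.iRefl V τ.perm i) seq w₀ ∧
        IQuiver.IsReducedExpr (IQuiver.simpleRefl V)
          (IQuiver.expand τ.perm (seq.map Subtype.val)) w₀ := by
  classical
  have hτ := τ.isDiagramInvolution hQ
  have hfin := hQ.finite_arrows
  have hreps : ∀ i, ∃ j ∈ I, j = i ∨ j = τ.perm i := fun i => by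
    obtain ⟨j, ⟨hjI, hj⟩, -⟩ := hI i
    exact ⟨j, hjI, hj⟩
  obtain ⟨l, hlI, hl, hall⟩ := exists_isAdapted hQ hτ
    (fun i j => congrArg Int.ofNat (τ.card_hom hQ i j)) hreps
  lift l to List I using hlI
  have hwτ := wordProd_mem hτ (l.map Subtype.val)
  have hwW := (mem_restrictedWeylGroup_iff.1 hwτ).1
  -- A positive root w y with y positive would contradict exhaustion, so every positive root is
  -- listed.
  have hmem : ∀ x, x ∈ betaList τ.perm (l.map Subtype.val) ↔ form V x x = 2 ∧ 0 ≤ x := fun x => by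
    obtain ⟨y, rfl⟩ := (wordProd τ.perm (l.map Subtype.val)).surjective x
    rw [hl.mem_iff, form_of_mem_weylGroup hwW]
    exact ⟨fun h => ⟨h.1, h.2.1⟩, fun h => ⟨h.1, h.2, fun hy => hall y h.1 hy h.2⟩⟩
  have hone : (fun i : V => iRefl V 1 (id i)) = simpleRefl V := funext iRefl_one
  have hinv : inversions hQ (wordProd τ.perm (l.map Subtype.val)) =
      (betaList τ.perm (l.map Subtype.val)).toFinset := by
    ext x
    rw [mem_inversions, List.mem_toFinset, hmem]
    exact and_iff_left_of_imp fun h => hall x h.1 h.2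
  refine ⟨l, hl.admissible, fun k _ => ?_, wordProd τ.perm (l.map Subtype.val), ?_, ?_, ?_, ?_⟩
  · refine isQAdmissible_of_eulerForm (fun x hx => eulerForm_pos hQ hx) hl.nodup
      (fun β => (hmem β).trans (mem_posRoots_iff hQ β).symm) (fun β hβ h1 => ?_) fun r t h => ?_
    · rw [hmem, hQ.isOrientation.form_self, ← eulerForm_eq, h1]
      exact ⟨rfl, hβ⟩
    · by_contra! hlt
      have := List.pairwise_iff_get.1 hl.pairwise t r hlt
      rw [eulerForm_eq] at h
      exact absurd h (not_lt.2 this)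
  -- The statement for W is the restricted one for the identity involution.
  · have h := isLongestElement_iRefl isDiagramInvolution_one hQ (id : V → V)
      (fun i => ⟨i, Or.inl rfl⟩) (w := wordProd τ.perm (l.map Subtype.val))
      (by rwa [restrictedWeylGroup_one]) hall
    rwa [restrictedWeylGroup_one, hone] at h
  · exact isLongestElement_iRefl hτ hQ (fun i : I => (i : V))
      (fun i => by
        obtain ⟨j, hjI, hj⟩ := hreps i
        exact ⟨⟨j, hjI⟩, hj⟩) hwτ hall
  · refine isReducedExpr_iRefl hτ hQ (fun i : I => (i : V)) l ?_ ?_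
    · rw [wordProd, List.map_map]
      rfl
    · rw [hl.length, List.length_map]
  -- For the identity every root has weight 2, so `twiceLength` is twice the number of inversions.
  -- These are exactly the listed roots, as many as the letters of the expanded word.
  · have h := isReducedExpr_iRefl isDiagramInvolution_one hQ (id : V → V)
      (expand τ.perm (l.map Subtype.val)) (w := wordProd τ.perm (l.map Subtype.val))
      (by rw [hone, prod_expand]) (by
        rw [twiceLength, hinv, ← hl.length_expand, Finset.sum_const_nat (m := 2) fun x _ => ?_,
          List.toFinset_card_of_nodup hl.nodup, mul_comm]
        exact if_pos rfl)
    rwa [hone] at h
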